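/- Let $G$ be a finite digraph with vertex set $V(G)$. A directed Steiner path cover of $G$ with respect to a set $T\subseteq V(G)$ of terminal vertices is a set of pairwise vertex-disjoint simple directed paths of $G$ (a single vertex counts as a path) that together contain all vertices of $T$; $p(G,T)$ denotes the minimum number of paths in such a cover. A directed Hamiltonian path of $G$ is a simple directed path that contains all vertices of $G$. Directed co-graphs are the digraphs generated from single-vertex digraphs by the following operations on vertex-disjoint digraphs $A,B$: the disjoint union $A\oplus B$; the order composition $A\oslash B$, which adds to $A\oplus B$ all arcs from $V(A)$ to $V(B)$; and the series composition $A\otimes B$, which adds to $A\oplus B$ all arcs between $V(A)$ and $V(B)$ in both directions. An expression that generates $G$ in this way is a directed co-expression of $G$; its size is the number of its vertices and operations. 1. A finite digraph $G$ has a directed Hamiltonian path if and only if $p(G,V(G))=1$. 2. The directed Hamiltonian path problem on directed co-graphs (decide whether a given directed co-graph has a directed Hamiltonian path) can be solved in linear time, and in the same time the value $p(G,V(G))$ can be computed. More precisely, on a random access machine with uniform cost (addition, truncated subtraction, zero tests and indirect addressing in one step each): (a) there are a program and a constant $c$ such that, for every directed co-graph $G$ with vertices $0,\dots,n-1$ and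 $m$ arcs, given by $n$, $m$ and a list of its arcs in any order, the program halts after at most $c\,(n+m)$ steps with the answer to the directed Hamiltonian path problem for $G$ and with $p(G,V(G))$; (b) there are a program and a constant $c$ such that, for every directed co-graph $G$ with vertices $0,\dots,n-1$ and every directed co-expression $X$ of $G$, given $X$ in postfix notation, the program halts after at most $c\cdot\mathrm{size}(X)$ steps with the same two results. -/

import Mathlib

/-! ### Directed paths, Hamiltonian paths and Steiner path covers -/

/-- A simple directed path of `G`, given by its nonempty list of pairwise distinct vertices, each
with an arc to the next one. A single vertex is a path (of length `0`). -/
structure IsDirPath {V : Type*} (G : Digraph V) (l : List V) : Prop where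
  ne_nil : l ≠ []
  nodup : l.Nodup
  chain : l.IsChain G.Adj

/-- `G` has a directed Hamiltonian path: a simple directed path through all vertices. -/
def HasHamiltonianPath {V : Type*} (G : Digraph V) : Prop :=
  ∃ l : List V, IsDirPath G l ∧ ∀ v : V, v ∈ l

/-- A directed Steiner path cover of `G` with respect to the terminal set `T`: a finite set of
pairwise vertex-disjoint simple directed paths of `G` that together contain all vertices of `T`
(and possibly further vertices). Its size is its cardinality. -/
structure IsSteinerPathCover {V : Type*} (G : Digraph V) (T : Set V) (C : Finset (List V)) :
    Prop where
  isPath : ∀ l ∈ C, IsDirPath G l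
  disjoint : ∀ l ∈ C, ∀ l' ∈ C, l ≠ l' → l.Disjoint l'
  covers : ∀ v ∈ T, ∃ l ∈ C, v ∈ l

/-- A directed Steiner path cover exists whenever the vertex set is finite: take every vertex as
a path of its own. So the minimum in `pathCoverNumber` is over a nonempty set. -/
theorem exists_isSteinerPathCover {V : Type*} [Finite V] (G : Digraph V) (T : Set V) :
    ∃ C : Finset (List V), IsSteinerPathCover G T C := by
  classical
  have : Fintype V := Fintype.ofFinite V
  refine ⟨Finset.univ.image (fun v : V => [v]), ?_, ?_, ?_⟩
  · intro l hl
    obtain ⟨v, -, rfl⟩ := Finset.mem_image.1 hl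
    exact ⟨by simp, by simp, by simp⟩
  · intro l hl l' hl' hne
    obtain ⟨v, -, rfl⟩ := Finset.mem_image.1 hl
    obtain ⟨w, -, rfl⟩ := Finset.mem_image.1 hl'
    simpa [eq_comm] using hne
  · intro v _
    exact ⟨[v], Finset.mem_image.2 ⟨v, Finset.mem_univ _, rfl⟩, by simp⟩

/-- `p(G, T)`: the minimum number of paths in a directed Steiner path cover of `G` with respect
to `T`. -/
noncomputable def pathCoverNumber {V : Type*} (G : Digraph V) (T : Set V) : ℕ :=
  sInf {k : ℕ | ∃ C : Finset (List V), IsSteinerPathCover G T C ∧ C.card = k}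

/-! ### Directed co-graphs -/

/-- Expressions built from single vertices by disjoint union `⊕`, order composition `⊘` and series
composition `⊗`; equivalently, binary directed co-trees with leaves labelled by vertices. -/
inductive CoExpr (V : Type*) where
  | vertex (v : V) : CoExpr V
  | union (A B : CoExpr V) : CoExpr V
  | order (A B : CoExpr V) : CoExpr V
  | series (A B : CoExpr V) : CoExpr V

namespace CoExpr

variable {V : Type*}

/-- The vertex set of the digraph defined by an expression. -/
def verts : CoExpr V → Set V
  | vertex v => {v}
  | union A B => A.verts ∪ B.verts
  | order A B => A.verts ∪ B.verts
  | series A B => A.verts ∪ B.verts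

/-- The arcs of the digraph defined by an expression. -/
def Adj : CoExpr V → V → V → Prop
  | vertex _, _, _ => False
  | union A B, u, v => A.Adj u v ∨ B.Adj u v
  | order A B, u, v => A.Adj u v ∨ B.Adj u v ∨ (u ∈ A.verts ∧ v ∈ B.verts)
  | series A B, u, v =>
      A.Adj u v ∨ B.Adj u v ∨ (u ∈ A.verts ∧ v ∈ B.verts) ∨ (u ∈ B.verts ∧ v ∈ A.verts)

/-- Every operation in the expression is applied to vertex-disjoint digraphs, that is, the
expression is a directed co-expression. -/
def VertexDisjoint : CoExpr V → Prop
  | vertex _ => True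
  | union A B => A.VertexDisjoint ∧ B.VertexDisjoint ∧ Disjoint A.verts B.verts
  | order A B => A.VertexDisjoint ∧ B.VertexDisjoint ∧ Disjoint A.verts B.verts
  | series A B => A.VertexDisjoint ∧ B.VertexDisjoint ∧ Disjoint A.verts B.verts

/-- The size of an expression: the number of nodes of the directed co-tree. -/
def size : CoExpr V → ℕ
  | vertex _ => 1
  | union A B => A.size + B.size + 1
  | order A B => A.size + B.size + 1
  | series A B => A.size + B.size + 1

/-- `e` is a directed co-expression for the digraph `G`. -/
def Represents (e : CoExpr V) (G : Digraph V) : Prop :=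
  e.VertexDisjoint ∧ e.verts = Set.univ ∧ ∀ u v : V, G.Adj u v ↔ e.Adj u v

/-- The word of an expression in postfix notation, over the natural numbers: the three operations
`⊕`, `⊘`, `⊗` are written as `0`, `1`, `2` and the vertex `v` is written as `v + 3`. -/
def code {n : ℕ} : CoExpr (Fin n) → List ℕ
  | vertex v => [v.val + 3]
  | union A B => A.code ++ B.code ++ [0]
  | order A B => A.code ++ B.code ++ [1]
  | series A B => A.code ++ B.code ++ [2]

end CoExpr

/-- `G` is a directed co-graph: it can be generated from single vertices by disjoint union, order
composition and series composition of vertex-disjoint digraphs. -/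
def IsDirectedCograph {V : Type*} (G : Digraph V) : Prop :=
  ∃ e : CoExpr V, e.Represents G

/-! ### Random access machines with uniform cost -/

/-- A memory state: registers `reg i`, and arrays `arr a` with cells `arr a i`. A program names
its registers and arrays by constants, so it uses finitely many of them. -/
structure RamState where
  reg : ℕ → ℕ
  arr : ℕ → ℕ → ℕ

/-- Expressions; `load a e` reads the cell of array `a` whose index is the value of `e`
(indirect addressing), and `sub` is truncated subtraction. -/
inductive RamExpr where
  | const (k : ℕ) : RamExpr
  | reg (i : ℕ) : RamExpr
  | load (a : ℕ) (e : RamExpr) : RamExpr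
  | add (e f : RamExpr) : RamExpr
  | sub (e f : RamExpr) : RamExpr

/-- The value of an expression. -/
def RamExpr.eval (s : RamState) : RamExpr → ℕ
  | const k => k
  | reg i => s.reg i
  | load a e => s.arr a (e.eval s)
  | add e f => e.eval s + f.eval s
  | sub e f => e.eval s - f.eval s

/-- The cost of evaluating an expression: the number of constants, register reads, array reads
and arithmetical operations in it. -/
def RamExpr.cost : RamExpr → ℕ
  | const _ => 1
  | reg _ => 1
  | load _ e => e.cost + 1
  | add e f => e.cost + f.cost + 1
  | sub e f => e.cost + f.cost + 1

/-- Programs. The test of `ite` and `loop` is passed when the value of `e` is not `0`. -/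
inductive RamProg where
  | skip : RamProg
  | assign (i : ℕ) (e : RamExpr) : RamProg
  | store (a : ℕ) (e f : RamExpr) : RamProg
  | seq (P Q : RamProg) : RamProg
  | ite (e : RamExpr) (P Q : RamProg) : RamProg
  | loop (e : RamExpr) (P : RamProg) : RamProg

/-- `RamExec P s t s'`: started in the state `s`, the program `P` halts after exactly `t` steps in
the state `s'`. Every operation counts one step. -/
inductive RamExec : RamProg → RamState → ℕ → RamState → Prop where
  | skip (s : RamState) : RamExec .skip s 1 s
  | assign (i : ℕ) (e : RamExpr) (s : RamState) :
      RamExec (.assign i e) s (e.cost + 1)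
        { s with reg := Function.update s.reg i (e.eval s) }
  | store (a : ℕ) (e f : RamExpr) (s : RamState) :
      RamExec (.store a e f) s (e.cost + f.cost + 1)
        { s with arr := Function.update s.arr a (Function.update (s.arr a) (e.eval s) (f.eval s)) }
  | seq {P Q : RamProg} {s s' s'' : RamState} {t t' : ℕ} :
      RamExec P s t s' → RamExec Q s' t' s'' → RamExec (.seq P Q) s (t + t') s''
  | ite_true {e : RamExpr} {P : RamProg} (Q : RamProg) {s s' : RamState} {t : ℕ} :
      e.eval s ≠ 0 → RamExec P s t s' → RamExec (.ite e P Q) s (e.cost + 1 + t) s'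
  | ite_false {e : RamExpr} (P : RamProg) {Q : RamProg} {s s' : RamState} {t : ℕ} :
      e.eval s = 0 → RamExec Q s t s' → RamExec (.ite e P Q) s (e.cost + 1 + t) s'
  | loop_true {e : RamExpr} {P : RamProg} {s s' s'' : RamState} {t t' : ℕ} :
      e.eval s ≠ 0 → RamExec P s t s' → RamExec (.loop e P) s' t' s'' →
      RamExec (.loop e P) s (e.cost + 1 + t + t') s''
  | loop_false {e : RamExpr} (P : RamProg) {s : RamState} :
      e.eval s = 0 → RamExec (.loop e P) s (e.cost + 1) s

/-- The result that the program `P` is to deliver for the digraph `G` when started in `s`: within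
`b` steps it halts with the answer to the directed Hamiltonian path problem (`1` for yes, `0` for
no) in register `0` and with `p(G, V(G))` in register `1`. -/
def SolvesHamiltonianPathWithin {V : Type*} (P : RamProg) (s : RamState) (G : Digraph V)
    (b : ℕ) : Prop :=
  ∃ (t : ℕ) (s' : RamState), RamExec P s t s' ∧ t ≤ b ∧
    (HasHamiltonianPath G → s'.reg 0 = 1) ∧ (¬ HasHamiltonianPath G → s'.reg 0 = 0) ∧
    s'.reg 1 = pathCoverNumber G Set.univ

/-- The list `l` enumerates the arcs of `G`, each arc exactly once, in any order. -/
def ListsArcs {n : ℕ} (G : Digraph (Fin n)) (l : List (Fin n × Fin n)) : Prop :=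
  l.Nodup ∧ ∀ u v : Fin n, (u, v) ∈ l ↔ G.Adj u v

/-- The input state for a digraph with vertices `0, …, n - 1` and arcs `l`: register `0` holds the
number of vertices, register `1` the number of arcs, and the cells `i` of the arrays `0` and `1`
hold the tail and the head of the `i`-th arc. All other memory is `0`. -/
def digraphInput (n : ℕ) (l : List (Fin n × Fin n)) : RamState where
  reg i := if i = 0 then n else if i = 1 then l.length else 0
  arr a i :=
    if a = 0 then (l.map fun x => x.1.val).getD i 0
    else if a = 1 then (l.map fun x => x.2.val).getD i 0
    else 0

/-- The input state for a word: register `0` holds its length and array `0` its letters. All other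
memory is `0`. -/
def wordInput (w : List ℕ) : RamState where
  reg i := if i = 0 then w.length else 0
  arr a i := if a = 0 then w.getD i 0 else 0

/-! ### Partitions of a vertex set into paths -/

/-! For `T = V(G)` a cover is a partition of the vertices into paths, so the task is to follow the
minimum number of paths through the three compositions. If the parts have path numbers a, b and x, y
vertices, then a disjoint union needs a + b paths, an order composition max(a, b), and a series
composition max(1, a - y, b - x) (`IsPathNumber.union`, `IsPathNumber.order`,
`IsPathNumber.series`). The upper bounds concatenate paths of the two parts; since paths can be
split, every number of paths between the minimum and the number of vertices is available for this.
The lower bounds restrict a partition of the whole to one part: in the first two compositions this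
creates no new pieces, and in a series composition deleting y vertices creates at most y of them.

Given a co-expression in postfix notation, these formulas are evaluated on a stack of pairs (path
number, number of vertices), with constant work per letter.

Given only the arcs, the program contracts twins instead of building an expression first. Two
disjoint modules are twins if they have the same neighbours outside their union; the union is then
again a module, and its path number is given by one of the formulas. In a directed co-graph every
partition of the vertices into at least two modules contains twins (`CoExpr.exists_twins`,
`IsDirectedCograph.exists_key_eq`), so when no twins are left, a single module is left and its path
number is the result.

Twins are found in constant time because a neighbourhood, written as a number of up to 2n binary
digits, is used as a table address. Whether there are arcs between the two modules gives four cases;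
adding a module to its own out- or in-neighbours turns each case into an equality of two numbers
(`adj_iff_of_key_eq`). Each round either merges a registered module into the current one or
registers the current one and passes to the next vertex, so there are at most 2n rounds. -/

/-- `C` lists vertex-disjoint simple paths of the relation `R` that together contain exactly the
vertices of `S`. -/
structure IsPathPartition {V : Type*} (R : V → V → Prop) (S : Finset V) (C : List (List V)) :
    Prop where
  ne_nil : ∀ l ∈ C, l ≠ []
  chain : ∀ l ∈ C, l.IsChain R
  nodup : C.flatten.Nodup
  mem : ∀ v, v ∈ C.flatten ↔ v ∈ S

/-- `p` is the minimum number of paths in a partition of `S` into paths. -/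
def IsPathNumber {V : Type*} (R : V → V → Prop) (S : Finset V) (p : ℕ) : Prop :=
  IsLeast {k | ∃ C, IsPathPartition R S C ∧ C.length = k} p

section PathPartition

variable {V : Type*} {R : V → V → Prop}

theorem IsPathPartition.length_flatten {S : Finset V} {C : List (List V)}
    (h : IsPathPartition R S C) : C.flatten.length = S.card := by
  classical
  rw [← List.toFinset_card_of_nodup h.nodup]
  congr 1
  ext v
  simpa using h.mem v

/-- Cutting and restricting paths may leave empty lists. Dropping them does not change the
concatenation, and the number of lists can only shrink. -/
theorem isPathPartition_filter_ne_nil {S : Finset V} {C : List (List V)}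
    (chain : ∀ l ∈ C, l.IsChain R) (nodup : C.flatten.Nodup) (mem : ∀ v, v ∈ C.flatten ↔ v ∈ S) :
    IsPathPartition R S (C.filter (· ≠ [])) := by
  refine ⟨?_, ?_, ?_, ?_⟩
  · intro l hl
    simpa using (List.mem_filter.1 hl).2
  · intro l hl
    exact chain l (List.mem_filter.1 hl).1
  · rwa [List.flatten_filter_ne_nil]
  · rwa [List.flatten_filter_ne_nil]

/-- With fewer paths than vertices, some path has two vertices, and its first vertex can be cut off.
-/
theorem IsPathPartition.exists_length_succ {S : Finset V} {C : List (List V)}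
    (h : IsPathPartition R S C) (hlt : C.length < S.card) :
    ∃ C', IsPathPartition R S C' ∧ C'.length = C.length + 1 := by
  have hex : ∃ l ∈ C, 2 ≤ l.length := by
    by_contra! hcon
    have : C.flatten.length ≤ C.length := by
      rw [List.length_flatten]
      calc (C.map List.length).sum ≤ (C.map List.length).length • 1 :=
            List.sum_le_card_nsmul _ _ (by
              intro x hx
              obtain ⟨l, hl, rfl⟩ := List.mem_map.1 hx
              have := hcon l hl
              omega)
        _ = C.length := by simp
    rw [h.length_flatten] at this
    omega
  obtain ⟨l, hl, hlen⟩ := hex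
  obtain ⟨C₁, C₂, rfl⟩ := List.append_of_mem hl
  obtain ⟨x, y, t, rfl⟩ : ∃ x y t, l = x :: y :: t := by
    match l, hlen with
    | x :: y :: t, _ => exact ⟨x, y, t, rfl⟩
  have hfl : (C₁ ++ [x] :: (y :: t) :: C₂).flatten = (C₁ ++ (x :: y :: t) :: C₂).flatten := by
    simp
  have hch := h.chain
  have hne := h.ne_nil
  refine ⟨C₁ ++ [x] :: (y :: t) :: C₂, ⟨?_, ?_, ?_, ?_⟩, by simp; omega⟩
  · intro l hl
    simp only [List.mem_append, List.mem_cons] at hl hne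
    rcases hl with hl | rfl | rfl | hl
    · exact hne l (Or.inl hl)
    · simp
    · simp
    · exact hne l (Or.inr (Or.inr hl))
  · intro l hl
    simp only [List.mem_append, List.mem_cons] at hl hch
    rcases hl with hl | rfl | rfl | hl
    · exact hch l (Or.inl hl)
    · simp
    · exact (hch _ (Or.inr (Or.inl rfl))).tail
    · exact hch l (Or.inr (Or.inr hl))
  · rw [hfl]; exact h.nodup
  · rw [hfl]; exact h.mem

theorem IsPathPartition.exists_length_eq {S : Finset V} {C : List (List V)}
    (h : IsPathPartition R S C) {k : ℕ} (h₁ : C.length ≤ k) (h₂ : k ≤ S.card) :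
    ∃ C', IsPathPartition R S C' ∧ C'.length = k := by
  induction k, h₁ using Nat.le_induction with
  | base => exact ⟨C, h, rfl⟩
  | succ k _ ih =>
    obtain ⟨C', h', rfl⟩ := ih (by omega)
    exact h'.exists_length_succ (by omega)

theorem IsPathNumber.exists_length_eq {S : Finset V} {p k : ℕ} (h : IsPathNumber R S p)
    (h₁ : p ≤ k) (h₂ : k ≤ S.card) : ∃ C, IsPathPartition R S C ∧ C.length = k := by
  obtain ⟨⟨C, hC, rfl⟩, -⟩ := h
  exact hC.exists_length_eq h₁ h₂

theorem IsPathPartition.length_le_card {S : Finset V} {C : List (List V)}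
    (h : IsPathPartition R S C) : C.length ≤ S.card := by
  rw [← h.length_flatten, List.length_flatten]
  calc C.length = (C.map List.length).length • 1 := by simp
    _ ≤ (C.map List.length).sum := List.card_nsmul_le_sum _ _ (by
        intro x hx
        obtain ⟨l, hl, rfl⟩ := List.mem_map.1 hx
        exact List.length_pos_iff.2 (h.ne_nil l hl))

theorem IsPathNumber.le_card {S : Finset V} {p : ℕ} (h : IsPathNumber R S p) : p ≤ S.card := by
  obtain ⟨⟨C, hC, rfl⟩, -⟩ := h
  exact hC.length_le_card

theorem IsPathPartition.length_pos {S : Finset V} {C : List (List V)}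
    (h : IsPathPartition R S C) (hS : S.Nonempty) : 1 ≤ C.length := by
  obtain ⟨v, hv⟩ := hS
  have := (h.mem v).2 hv
  rw [List.mem_flatten] at this
  obtain ⟨l, hl, -⟩ := this
  exact List.length_pos_of_mem hl

theorem IsPathNumber.pos {S : Finset V} {p : ℕ} (h : IsPathNumber R S p) (hS : S.Nonempty) :
    1 ≤ p := by
  obtain ⟨⟨C, hC, rfl⟩, -⟩ := h
  exact hC.length_pos hS

theorem isPathNumber_singleton (v : V) : IsPathNumber R {v} 1 := by
  refine ⟨⟨[[v]], ⟨by simp, by simp, by simp, by simp⟩, rfl⟩, ?_⟩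
  rintro k ⟨C, hC, rfl⟩
  exact hC.length_pos ⟨v, by simp⟩

theorem IsPathPartition.append [DecidableEq V] {A B : Finset V} {C D : List (List V)}
    (hC : IsPathPartition R A C) (hD : IsPathPartition R B D) (hAB : Disjoint A B) :
    IsPathPartition R (A ∪ B) (C ++ D) := by
  refine ⟨?_, ?_, ?_, ?_⟩
  · intro l hl
    rcases List.mem_append.1 hl with hl | hl
    exacts [hC.ne_nil l hl, hD.ne_nil l hl]
  · intro l hl
    rcases List.mem_append.1 hl with hl | hl
    exacts [hC.chain l hl, hD.chain l hl]
  · rw [List.flatten_append, List.nodup_append']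
    refine ⟨hC.nodup, hD.nodup, ?_⟩
    intro v hv hv'
    exact Finset.disjoint_left.1 hAB ((hC.mem v).1 hv) ((hD.mem v).1 hv')
  · intro v
    rw [List.flatten_append, List.mem_append, hC.mem, hD.mem, Finset.mem_union]

/-! #### Restricting a path partition -/

/-- Along the list the property can only be lost, never regained, so filtering keeps an initial
segment. -/
theorem List.IsChain.filter_of_backward {P : V → Prop} [DecidablePred P] {l : List V}
    (h : l.IsChain R) (hP : ∀ x ∈ l, ∀ y ∈ l, R x y → P y → P x) :
    (l.filter P).IsChain R := by
  have key : ∀ (x : V) (t : List V), (x :: t).IsChain R →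
      (∀ a ∈ x :: t, ∀ b ∈ x :: t, R a b → P b → P a) → ¬ P x → t.filter P = [] := by
    intro x t
    induction t generalizing x with
    | nil => simp
    | cons y t ih =>
      intro hc hb hx
      have hxy := (List.isChain_cons_cons.1 hc)
      have hy : ¬ P y := fun hy => hx (hb x (by simp) y (by simp) hxy.1 hy)
      rw [List.filter_cons_of_neg (by simpa using hy)]
      exact ih y hxy.2 (fun a ha b hb' => hb a (List.mem_cons_of_mem _ ha) b
        (List.mem_cons_of_mem _ hb')) hy
  induction l with
  | nil => simp
  | cons x t ih =>
    by_cases hx : P x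
    · rw [List.filter_cons_of_pos (by simpa using hx)]
      refine List.IsChain.cons (ih h.tail fun a ha b hb => hP a (List.mem_cons_of_mem _ ha) b
        (List.mem_cons_of_mem _ hb)) ?_
      intro z hz
      match t, h, hP, hz with
      | [], _, _, hz => simp at hz
      | y :: t, h, hP, hz =>
        have hxy := List.isChain_cons_cons.1 h
        by_cases hy : P y
        · rw [List.filter_cons_of_pos (by simpa using hy)] at hz
          simp only [List.head?_cons, Option.mem_def, Option.some.injEq] at hz
          exact hz ▸ hxy.1
        · rw [List.filter_cons_of_neg (by simpa using hy), key y t hxy.2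
            (fun a ha b hb => hP a (List.mem_cons_of_mem _ ha) b (List.mem_cons_of_mem _ hb)) hy]
            at hz
          simp at hz
    · rw [List.filter_cons_of_neg (by simpa using hx), key x t h hP hx]
      simp

theorem List.IsChain.filter_of_forward {P : V → Prop} [DecidablePred P] {l : List V}
    (h : l.IsChain R) (hP : ∀ x ∈ l, ∀ y ∈ l, R x y → P x → P y) :
    (l.filter P).IsChain R := by
  rw [← List.isChain_reverse, ← List.filter_reverse]
  refine List.IsChain.filter_of_backward (List.isChain_reverse.2 h) ?_
  intro x hx y hy hxy
  exact hP y (by simpa using hy) x (by simpa using hx) hxy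

theorem IsPathPartition.filter {S A : Finset V} {C : List (List V)} [DecidablePred (· ∈ A)]
    (h : IsPathPartition R S C) (hA : A ⊆ S)
    (hch : ∀ l ∈ C, (l.filter (· ∈ A)).IsChain R) :
    IsPathPartition R A ((C.map (List.filter (· ∈ A))).filter (· ≠ [])) := by
  have hfl : (C.map (List.filter (· ∈ A))).flatten = C.flatten.filter (· ∈ A) :=
    List.filter_flatten.symm
  refine isPathPartition_filter_ne_nil ?_ ?_ ?_
  · intro l hl
    obtain ⟨l', hl', rfl⟩ := List.mem_map.1 hl
    exact hch l' hl'
  · rw [hfl]; exact h.nodup.filter _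
  · intro v
    rw [hfl, List.mem_filter, h.mem]
    simp only [decide_eq_true_eq, and_iff_right_iff_imp]
    exact fun hv => hA hv

/-- A removed vertex cuts its path into at most two pieces, either of which may be empty. -/
theorem IsPathPartition.exists_erase [DecidableEq V] {S : Finset V} {C : List (List V)}
    (h : IsPathPartition R S C) {v : V} (hv : v ∈ S) :
    ∃ C', IsPathPartition R (S.erase v) C' ∧ C'.length ≤ C.length + 1 := by
  obtain ⟨l, hl, hvl⟩ := List.mem_flatten.1 ((h.mem v).2 hv)
  obtain ⟨C₁, C₂, rfl⟩ := List.append_of_mem hl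
  obtain ⟨l₁, l₂, rfl⟩ := List.append_of_mem hvl
  have hch := h.chain
  simp only [List.mem_append, List.mem_cons] at hch
  have hl := hch _ (Or.inr (Or.inl rfl))
  have hfl : (C₁ ++ (l₁ ++ v :: l₂) :: C₂).flatten.Perm
      (v :: (C₁ ++ l₁ :: l₂ :: C₂).flatten) := by
    simp only [List.flatten_append, List.flatten_cons, List.append_assoc, List.cons_append]
    rw [← List.append_assoc, ← List.append_assoc]
    exact List.perm_middle
  have hnd := hfl.nodup_iff.1 h.nodup
  rw [List.nodup_cons] at hnd
  refine ⟨_, isPathPartition_filter_ne_nil (C := C₁ ++ l₁ :: l₂ :: C₂) ?_ hnd.2 ?_, ?_⟩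
  · intro l hl'
    simp only [List.mem_append, List.mem_cons] at hl'
    rcases hl' with hl' | rfl | rfl | hl'
    · exact hch l (Or.inl hl')
    · exact hl.left_of_append
    · exact hl.right_of_append.tail
    · exact hch l (Or.inr (Or.inr hl'))
  · intro w
    have := h.mem w
    rw [hfl.mem_iff, List.mem_cons] at this
    rw [Finset.mem_erase, ← this]
    constructor
    · intro hw
      exact ⟨fun e => hnd.1 (e ▸ hw), Or.inr hw⟩
    · rintro ⟨hne, rfl | hw⟩
      exacts [absurd rfl hne, hw]
  · refine (List.length_filter_le _ _).trans ?_
    simp only [List.length_append, List.length_cons]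
    omega

theorem IsPathPartition.exists_sdiff [DecidableEq V] {S : Finset V} {C : List (List V)}
    (h : IsPathPartition R S C) (B : Finset V) (hB : B ⊆ S) :
    ∃ C', IsPathPartition R (S \ B) C' ∧ C'.length ≤ C.length + B.card := by
  induction B using Finset.induction_on with
  | empty => exact ⟨C, by simpa using h, by simp⟩
  | insert v B hv ih =>
    obtain ⟨C', h', hlen⟩ := ih fun x hx => hB (Finset.mem_insert_of_mem hx)
    obtain ⟨C'', h'', hlen'⟩ := h'.exists_erase (v := v)
      (Finset.mem_sdiff.2 ⟨hB (Finset.mem_insert_self _ _), hv⟩)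
    refine ⟨C'', ?_, ?_⟩
    · rwa [← Finset.sdiff_insert] at h''
    · rw [Finset.card_insert_of_notMem hv]; omega

/-! #### Disjoint union -/

/-- Used for the lower bound of a disjoint union: no path meets both parts, so each path survives at
most one of the two restrictions. -/
theorem List.length_filter_map_add_le {α : Type*} (f g : List α → List α) (C : List (List α))
    (h : ∀ l ∈ C, f l = [] ∨ g l = []) :
    ((C.map f).filter (· ≠ [])).length + ((C.map g).filter (· ≠ [])).length ≤ C.length := by
  induction C with
  | nil => simp
  | cons l C ih =>
    have ih := ih fun l' hl' => h l' (List.mem_cons_of_mem _ hl')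
    have hl := h l (by simp)
    simp only [List.map_cons, List.filter_cons, List.length_cons]
    split_ifs with h₁ h₂ h₂
    · simp only [decide_eq_true_eq] at h₁ h₂
      exact absurd hl (by simp [h₁, h₂])
    · simp only [List.length_cons]
      omega
    · simp only [List.length_cons]
      omega
    · omega

theorem IsPathNumber.union [DecidableEq V] {A B : Finset V} {a b : ℕ} (hA : IsPathNumber R A a)
    (hB : IsPathNumber R B b) (hAB : Disjoint A B) (h₁ : ∀ x ∈ A, ∀ y ∈ B, ¬ R x y)
    (h₂ : ∀ x ∈ A, ∀ y ∈ B, ¬ R y x) : IsPathNumber R (A ∪ B) (a + b) := by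
  constructor
  · obtain ⟨⟨C, hC, rfl⟩, -⟩ := hA
    obtain ⟨⟨D, hD, rfl⟩, -⟩ := hB
    exact ⟨C ++ D, hC.append hD hAB, by simp⟩
  · rintro k ⟨C, hC, rfl⟩
    have hmem : ∀ l ∈ C, ∀ x ∈ l, x ∈ A ∪ B := fun l hl x hx =>
      (hC.mem x).1 (List.mem_flatten.2 ⟨l, hl, hx⟩)
    have hiff : ∀ l ∈ C, ∀ x ∈ l, ∀ y ∈ l, R x y → (x ∈ A ↔ y ∈ A) := by
      intro l hl x hx y hy hxy
      have hx' := Finset.mem_union.1 (hmem l hl x hx)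
      have hy' := Finset.mem_union.1 (hmem l hl y hy)
      constructor
      · intro h
        exact hy'.resolve_right fun h' => h₁ x h y h' hxy
      · intro h
        exact hx'.resolve_right fun h' => h₂ y h x h' hxy
    have hside : ∀ l : List V, l.IsChain R → (∀ x ∈ l, ∀ y ∈ l, R x y → (x ∈ A ↔ y ∈ A)) →
        (∀ x ∈ l, x ∈ A) ∨ (∀ x ∈ l, x ∉ A) := by
      intro l
      induction l with
      | nil => simp
      | cons x t ih =>
        intro hc hxy
        match t, hc, hxy, ih with
        | [], _, _, _ => simpa using em (x ∈ A)
        | y :: t, hc, hxy, ih =>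
          have hR := List.isChain_cons_cons.1 hc
          have hx := hxy x (by simp) y (by simp) hR.1
          rcases ih hR.2 (fun a ha b hb => hxy a (List.mem_cons_of_mem _ ha) b
            (List.mem_cons_of_mem _ hb)) with h | h
          · exact Or.inl (List.forall_mem_cons.2 ⟨hx.2 (h y (by simp)), h⟩)
          · exact Or.inr (List.forall_mem_cons.2 ⟨fun h' => h y (by simp) (hx.1 h'), h⟩)
    have hBA : ∀ x ∈ B, x ∉ A := fun x hx hx' => Finset.disjoint_left.1 hAB hx' hx
    have hCA := hA.2 ⟨_, hC.filter (A := A) Finset.subset_union_left (fun l hl =>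
      (hC.chain l hl).filter_of_backward fun x hx y hy hxy => (hiff l hl x hx y hy hxy).2), rfl⟩
    have hCB := hB.2 ⟨_, hC.filter (A := B) Finset.subset_union_right (fun l hl =>
      (hC.chain l hl).filter_of_backward fun x hx y hy hxy hy' => by
        refine (Finset.mem_union.1 (hmem l hl x hx)).resolve_left fun h => ?_
        exact hBA y hy' ((hiff l hl x hx y hy hxy).1 h)), rfl⟩
    refine (Nat.add_le_add hCA hCB).trans (List.length_filter_map_add_le _ _ C fun l hl => ?_)
    rcases hside l (hC.chain l hl) (hiff l hl) with h | h
    · right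
      simp only [List.filter_eq_nil_iff, decide_eq_true_eq]
      exact fun x hx hx' => hBA x hx' (h x hx)
    · left
      simpa only [List.filter_eq_nil_iff, decide_eq_true_eq] using h

/-! #### Order composition -/

/-- Concatenates the lists of the two arguments in pairs; what is left over is kept. -/
def List.zipAppend {α : Type*} : List (List α) → List (List α) → List (List α)
  | [], M => M
  | L, [] => L
  | l :: L, m :: M => (l ++ m) :: List.zipAppend L M

theorem List.length_zipAppend {α : Type*} (L M : List (List α)) :
    (L.zipAppend M).length = max L.length M.length := by
  induction L, M using List.zipAppend.induct with
  | case1 M => simp [List.zipAppend]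
  | case2 L h => cases L <;> simp [List.zipAppend]
  | case3 l L m M ih => simp [List.zipAppend, ih]

theorem List.flatten_zipAppend_perm {α : Type*} (L M : List (List α)) :
    (L.zipAppend M).flatten.Perm (L.flatten ++ M.flatten) := by
  induction L, M using List.zipAppend.induct with
  | case1 M => simp [List.zipAppend]
  | case2 L h => cases L <;> simp [List.zipAppend]
  | case3 l L m M ih =>
    simp only [List.zipAppend, List.flatten_cons, List.append_assoc]
    refine List.Perm.append_left _ ((ih.append_left m).trans ?_)
    rw [← List.append_assoc, ← List.append_assoc]
    exact List.perm_append_comm.append_right _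

theorem List.forall_mem_zipAppend {α : Type*} {P : List α → Prop} (L M : List (List α))
    (hL : ∀ l ∈ L, P l) (hM : ∀ l ∈ M, P l) (hLM : ∀ l ∈ L, ∀ m ∈ M, P (l ++ m)) :
    ∀ l ∈ L.zipAppend M, P l := by
  induction L, M using List.zipAppend.induct with
  | case1 M => exact hM
  | case2 L h => cases L <;> exact hL
  | case3 l L m M ih =>
    simp only [List.zipAppend, List.forall_mem_cons] at *
    exact ⟨hLM.1.1, ih hL.2 hM.2 fun l' hl' => (hLM.2 l' hl').2⟩

theorem isPathPartition_of_perm [DecidableEq V] {A B : Finset V} {C D E : List (List V)}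
    (hC : IsPathPartition R A C) (hD : IsPathPartition R B D) (hAB : Disjoint A B)
    (hE : E.flatten.Perm (C.flatten ++ D.flatten)) (hne : ∀ l ∈ E, l ≠ [])
    (hch : ∀ l ∈ E, l.IsChain R) : IsPathPartition R (A ∪ B) E := by
  have h := hC.append hD hAB
  rw [← List.flatten_append] at hE
  exact ⟨hne, hch, hE.nodup_iff.2 h.nodup, fun v => hE.mem_iff.trans (h.mem v)⟩

/-- Upper bound: put paths of `A` in front of paths of `B`, pair by pair. Lower bound: no arc leads
back to `A`, so every path is a segment in `A` followed by a segment in `B`, and restriction to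
either part creates no new pieces. -/
theorem IsPathNumber.order [DecidableEq V] {A B : Finset V} {a b : ℕ} (hA : IsPathNumber R A a)
    (hB : IsPathNumber R B b) (hAB : Disjoint A B) (h₁ : ∀ x ∈ A, ∀ y ∈ B, R x y)
    (h₂ : ∀ x ∈ A, ∀ y ∈ B, ¬ R y x) : IsPathNumber R (A ∪ B) (max a b) := by
  constructor
  · obtain ⟨⟨C, hC, rfl⟩, -⟩ := hA
    obtain ⟨⟨D, hD, rfl⟩, -⟩ := hB
    refine ⟨C.zipAppend D, isPathPartition_of_perm hC hD hAB (List.flatten_zipAppend_perm C D)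
      ?_ ?_, List.length_zipAppend C D⟩
    · refine List.forall_mem_zipAppend _ _ hC.ne_nil hD.ne_nil fun l hl m _ => ?_
      simp [hC.ne_nil l hl]
    · refine List.forall_mem_zipAppend _ _ hC.chain hD.chain fun l hl m hm => ?_
      refine (hC.chain l hl).append (hD.chain m hm) fun x hx y hy => h₁ x ?_ y ?_
      · exact (hC.mem x).1 (List.mem_flatten.2 ⟨l, hl, List.mem_of_mem_getLast? hx⟩)
      · exact (hD.mem y).1 (List.mem_flatten.2 ⟨m, hm, List.mem_of_mem_head? hy⟩)
  · rintro k ⟨C, hC, rfl⟩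
    have hmem : ∀ l ∈ C, ∀ x ∈ l, x ∈ A ∪ B := fun l hl x hx =>
      (hC.mem x).1 (List.mem_flatten.2 ⟨l, hl, hx⟩)
    refine max_le ?_ ?_
    · refine (hA.2 ⟨_, hC.filter (A := A) Finset.subset_union_left (fun l hl =>
        (hC.chain l hl).filter_of_backward fun x hx y hy hxy hy' => ?_), rfl⟩).trans
        ((List.length_filter_le _ _).trans (by simp))
      exact (Finset.mem_union.1 (hmem l hl x hx)).resolve_right fun hx' => h₂ y hy' x hx' hxy
    · refine (hB.2 ⟨_, hC.filter (A := B) Finset.subset_union_right (fun l hl =>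
        (hC.chain l hl).filter_of_forward fun x hx y hy hxy hx' => ?_), rfl⟩).trans
        ((List.length_filter_le _ _).trans (by simp))
      exact (Finset.mem_union.1 (hmem l hl y hy)).resolve_left fun hy' => h₂ y hy' x hx' hxy

/-! #### Series composition -/

/-- Concatenates the lists of the two arguments alternately, beginning with the first argument. -/
def List.alternate {α : Type*} : List (List α) → List (List α) → List α
  | [], _ => []
  | l :: L, M => l ++ List.alternate M L
termination_by L M => L.length + M.length

theorem List.alternate_perm {α : Type*} (L M : List (List α))
    (h : L.length = M.length ∨ L.length = M.length + 1) :
    (List.alternate L M).Perm (L.flatten ++ M.flatten) := by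
  induction L, M using List.alternate.induct with
  | case1 M =>
    have : M = [] := List.eq_nil_of_length_eq_zero (by simp at h; omega)
    simp [this, List.alternate]
  | case2 l L M ih =>
    rw [List.alternate, List.flatten_cons, List.append_assoc]
    refine List.Perm.append_left _ ((ih ?_).trans List.perm_append_comm)
    simp only [List.length_cons] at h
    omega

theorem List.isChain_alternate (L M : List (List V)) (hL : ∀ l ∈ L, l ≠ [] ∧ l.IsChain R)
    (hM : ∀ l ∈ M, l ≠ [] ∧ l.IsChain R) (h₁ : ∀ x ∈ L.flatten, ∀ y ∈ M.flatten, R x y)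
    (h₂ : ∀ x ∈ L.flatten, ∀ y ∈ M.flatten, R y x) : (List.alternate L M).IsChain R := by
  induction L, M using List.alternate.induct with
  | case1 M => simp [List.alternate]
  | case2 l L M ih =>
    rw [List.alternate]
    rw [List.forall_mem_cons] at hL
    simp only [List.flatten_cons, List.mem_append] at h₁ h₂
    refine hL.1.2.append (ih hM hL.2 (fun x hx y hy => h₂ y (Or.inr hy) x hx)
      fun x hx y hy => h₁ y (Or.inr hy) x hx) fun x hx y hy => ?_
    refine h₁ x (Or.inl (List.mem_of_mem_getLast? hx)) y ?_
    match M, hM, hy with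
    | [], _, hy => simp [List.alternate] at hy
    | m :: M, hM, hy =>
      rw [List.alternate, List.head?_append_of_ne_nil _ (hM m (by simp)).1] at hy
      rw [List.flatten_cons, List.mem_append]
      exact Or.inl (List.mem_of_mem_head? hy)

/-- The paths of `D` serve as links: each of them joins two paths of `C`, as long as there are
enough paths of `C`. -/
theorem exists_isPathPartition_series [DecidableEq V] {A B : Finset V} {C D : List (List V)}
    (hC : IsPathPartition R A C) (hD : IsPathPartition R B D) (hAB : Disjoint A B)
    (h₁ : ∀ x ∈ A, ∀ y ∈ B, R x y) (h₂ : ∀ x ∈ A, ∀ y ∈ B, R y x) (hC₀ : C ≠ [])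
    (hlen : D.length ≤ C.length) :
    ∃ E, IsPathPartition R (A ∪ B) E ∧ E.length = max 1 (C.length - D.length) := by
  -- The `D.length` links can join `D.length + 1` paths. If both parts have equally many paths, all
  -- of them are used and the alternation ends with a path of `D`.
  set k := min C.length (D.length + 1) with hk
  have hk₁ : 1 ≤ k := by
    have := List.length_pos_iff.2 hC₀
    omega
  have hperm : (List.alternate (C.take k) D :: C.drop k).flatten.Perm
      (C.flatten ++ D.flatten) := by
    rw [List.flatten_cons]
    refine ((List.alternate_perm (C.take k) D ?_).append_right _).trans ?_
    · rw [List.length_take]; omega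
    · conv_rhs => rw [← List.take_append_drop k C, List.flatten_append]
      rw [List.append_assoc, List.append_assoc]
      exact List.perm_append_comm.append_left _
  have htake : ∀ l ∈ C.take k, l ∈ C := fun l hl => List.mem_of_mem_take hl
  have hmemC : ∀ x ∈ (C.take k).flatten, x ∈ A := fun x hx => by
    obtain ⟨l, hl, hxl⟩ := List.mem_flatten.1 hx
    exact (hC.mem x).1 (List.mem_flatten.2 ⟨l, htake l hl, hxl⟩)
  refine ⟨_, isPathPartition_of_perm hC hD hAB hperm ?_ ?_, ?_⟩
  · intro l hl
    rcases List.mem_cons.1 hl with rfl | hl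
    · obtain ⟨l, L, hL⟩ : ∃ l L, C.take k = l :: L := by
        cases hcase : C.take k with
        | nil =>
          have := congrArg List.length hcase
          rw [List.length_take] at this
          simp only [List.length_nil] at this
          omega
        | cons l L => exact ⟨l, L, rfl⟩
      rw [hL, List.alternate]
      have := hC.ne_nil l (htake l (by simp [hL]))
      simp [this]
    · exact hC.ne_nil l (List.mem_of_mem_drop hl)
  · intro l hl
    rcases List.mem_cons.1 hl with rfl | hl
    · exact List.isChain_alternate _ _
        (fun l hl => ⟨hC.ne_nil l (htake l hl), hC.chain l (htake l hl)⟩)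
        (fun l hl => ⟨hD.ne_nil l hl, hD.chain l hl⟩)
        (fun x hx y hy => h₁ x (hmemC x hx) y ((hD.mem y).1 hy))
        (fun x hx y hy => h₂ x (hmemC x hx) y ((hD.mem y).1 hy))
    · exact hC.chain l (List.mem_of_mem_drop hl)
  · rw [List.length_cons, List.length_drop]
    omega

/-- Upper bound: if one part has at least as many paths as the other has vertices, the latter is
dissolved into single vertices to give as many links as possible. Lower bound: `k` paths on the
union leave at most `k + B.card` paths on `A` after the vertices of `B` are deleted, and
symmetrically. -/
theorem IsPathNumber.series [DecidableEq V] {A B : Finset V} {a b : ℕ} (hA : IsPathNumber R A a)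
    (hB : IsPathNumber R B b) (hA₀ : A.Nonempty) (hB₀ : B.Nonempty) (hAB : Disjoint A B)
    (h₁ : ∀ x ∈ A, ∀ y ∈ B, R x y) (h₂ : ∀ x ∈ A, ∀ y ∈ B, R y x) :
    IsPathNumber R (A ∪ B) (max 1 (max (a - B.card) (b - A.card))) := by
  have ha := hA.le_card
  have hb := hB.le_card
  have ha' := hA.pos hA₀
  have hb' := hB.pos hB₀
  have hAc := hA₀.card_pos
  have hBc := hB₀.card_pos
  constructor
  · by_cases hcase : B.card ≤ a
    · obtain ⟨C, hC, hCl⟩ := hA.exists_length_eq le_rfl ha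
      obtain ⟨D, hD, hDl⟩ := hB.exists_length_eq hb le_rfl
      obtain ⟨E, hE, hEl⟩ := exists_isPathPartition_series hC hD hAB h₁ h₂
        (List.length_pos_iff.1 (by omega)) (by omega)
      exact ⟨E, hE, by omega⟩
    by_cases hcase' : A.card ≤ b
    · obtain ⟨C, hC, hCl⟩ := hA.exists_length_eq ha le_rfl
      obtain ⟨D, hD, hDl⟩ := hB.exists_length_eq le_rfl hb
      obtain ⟨E, hE, hEl⟩ := exists_isPathPartition_series hD hC hAB.symm
        (fun x hx y hy => h₂ y hy x hx) (fun x hx y hy => h₁ y hy x hx)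
        (List.length_pos_iff.1 (by omega)) (by omega)
      rw [Finset.union_comm] at hE
      exact ⟨E, hE, by omega⟩
    -- In the remaining case both parts can be split into equally many paths, which alternate to a
    -- Hamiltonian path.
    obtain ⟨C, hC, hCl⟩ := hA.exists_length_eq (k := max a b) (by omega) (by omega)
    obtain ⟨D, hD, hDl⟩ := hB.exists_length_eq (k := max a b) (by omega) (by omega)
    obtain ⟨E, hE, hEl⟩ := exists_isPathPartition_series hC hD hAB h₁ h₂
      (List.length_pos_iff.1 (by omega)) (by omega)
    exact ⟨E, hE, by omega⟩
  · rintro k ⟨C, hC, rfl⟩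
    have h1 := hC.length_pos (hA₀.mono Finset.subset_union_left)
    obtain ⟨D, hD, hDl⟩ := hC.exists_sdiff B Finset.subset_union_right
    obtain ⟨E, hE, hEl⟩ := hC.exists_sdiff A Finset.subset_union_left
    rw [Finset.union_sdiff_cancel_right hAB] at hD
    rw [Finset.union_sdiff_cancel_left hAB] at hE
    have := hA.2 ⟨D, hD, rfl⟩
    have := hB.2 ⟨E, hE, rfl⟩
    omega

end PathPartition

/-! ### Path partitions of all vertices and the path cover number -/

theorem IsPathPartition.isSteinerPathCover {V : Type*} [Fintype V] {G : Digraph V}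
    {C : List (List V)} (h : IsPathPartition G.Adj Finset.univ C) :
    ∃ D : Finset (List V), IsSteinerPathCover G Set.univ D ∧ D.card = C.length := by
  classical
  have hnd := List.nodup_flatten.1 h.nodup
  -- Lists at different positions are disjoint and nonempty, hence different, so passing to a finset
  -- does not lose any.
  have hC : C.Nodup := by
    refine List.Pairwise.imp_of_mem ?_ hnd.2
    rintro l m hl - hlm rfl
    obtain ⟨x, hx⟩ := List.exists_mem_of_ne_nil l (h.ne_nil l hl)
    exact hlm hx hx
  refine ⟨C.toFinset, ⟨?_, ?_, ?_⟩, List.toFinset_card_of_nodup hC⟩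
  · intro l hl
    rw [List.mem_toFinset] at hl
    exact ⟨h.ne_nil l hl, hnd.1 l hl, h.chain l hl⟩
  · intro l hl m hm hne
    rw [List.mem_toFinset] at hl hm
    have : Std.Symm (List.Disjoint (α := V)) := ⟨fun _ _ h => h.symm⟩
    exact hnd.2.forall hl hm hne
  · intro v _
    obtain ⟨l, hl, hv⟩ := List.mem_flatten.1 ((h.mem v).2 (Finset.mem_univ v))
    exact ⟨l, List.mem_toFinset.2 hl, hv⟩

theorem IsSteinerPathCover.isPathPartition {V : Type*} [Fintype V] {G : Digraph V}
    {D : Finset (List V)} (h : IsSteinerPathCover G Set.univ D) :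
    IsPathPartition G.Adj Finset.univ D.toList := by
  refine ⟨fun l hl => (h.isPath l (Finset.mem_toList.1 hl)).ne_nil,
    fun l hl => (h.isPath l (Finset.mem_toList.1 hl)).chain, List.nodup_flatten.2 ⟨?_, ?_⟩, ?_⟩
  · exact fun l hl => (h.isPath l (Finset.mem_toList.1 hl)).nodup
  · refine D.nodup_toList.imp_of_mem fun {l m} hl hm hne => ?_
    exact h.disjoint l (Finset.mem_toList.1 hl) m (Finset.mem_toList.1 hm) hne
  · intro v
    obtain ⟨l, hl, hv⟩ := h.covers v (Set.mem_univ v)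
    simp only [Finset.mem_univ, iff_true]
    exact List.mem_flatten.2 ⟨l, Finset.mem_toList.2 hl, hv⟩

theorem IsPathNumber.pathCoverNumber_eq {V : Type*} [Fintype V] {G : Digraph V} {p : ℕ}
    (h : IsPathNumber G.Adj Finset.univ p) : pathCoverNumber G Set.univ = p := by
  have hset : {k : ℕ | ∃ C : Finset (List V), IsSteinerPathCover G Set.univ C ∧ C.card = k} =
      {k | ∃ C, IsPathPartition G.Adj Finset.univ C ∧ C.length = k} := by
    ext k
    constructor
    · rintro ⟨D, hD, rfl⟩
      exact ⟨D.toList, hD.isPathPartition, D.length_toList⟩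
    · rintro ⟨C, hC, rfl⟩
      exact hC.isSteinerPathCover
  rw [pathCoverNumber, hset]
  exact h.csInf_eq

theorem hasHamiltonianPath_iff_pathCoverNumber_eq_one {V : Type*} [Finite V] (G : Digraph V) :
    HasHamiltonianPath G ↔ pathCoverNumber G Set.univ = 1 := by
  have hne : {k : ℕ | ∃ C : Finset (List V),
      IsSteinerPathCover G Set.univ C ∧ C.card = k}.Nonempty := by
    obtain ⟨C, hC⟩ := exists_isSteinerPathCover G Set.univ
    exact ⟨C.card, C, hC, rfl⟩
  constructor
  · rintro ⟨l, hl, hmem⟩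
    apply le_antisymm
    · refine Nat.sInf_le ⟨{l}, ⟨?_, ?_, ?_⟩, by simp⟩
      · simpa using hl
      · simp
      · simpa using hmem
    -- The given path has a vertex, so no cover is empty. On the empty vertex set both sides of the
    -- equivalence are false.
    · obtain ⟨C, hC, hcard⟩ := Nat.sInf_mem hne
      rw [pathCoverNumber, ← hcard, Nat.succ_le_iff, Finset.card_pos]
      obtain ⟨v, -⟩ := List.exists_mem_of_ne_nil l hl.ne_nil
      obtain ⟨m, hm, -⟩ := hC.covers v (Set.mem_univ v)
      exact ⟨m, hm⟩
  · intro h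
    obtain ⟨C, hC, hcard⟩ := Nat.sInf_mem hne
    have hcard : C.card = 1 := hcard.trans h
    obtain ⟨l, rfl⟩ := Finset.card_eq_one.1 hcard
    refine ⟨l, hC.isPath l (by simp), fun v => ?_⟩
    obtain ⟨m, hm, hv⟩ := hC.covers v (Set.mem_univ v)
    rwa [Finset.mem_singleton.1 hm] at hv

/-! ### Running programs -/

/-- A program without loops. -/
def RamProg.LoopFree : RamProg → Prop
  | skip => True
  | assign _ _ => True
  | store _ _ _ => True
  | seq P Q => P.LoopFree ∧ Q.LoopFree
  | ite _ P Q => P.LoopFree ∧ Q.LoopFree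
  | loop _ _ => False

/-- The final state of a program without loops. -/
def RamProg.run : RamProg → RamState → RamState
  | skip, s => s
  | assign i e, s => { s with reg := Function.update s.reg i (e.eval s) }
  | store a e f, s =>
      { s with arr := Function.update s.arr a (Function.update (s.arr a) (e.eval s) (f.eval s)) }
  | seq P Q, s => Q.run (P.run s)
  | ite e P Q, s => if e.eval s ≠ 0 then P.run s else Q.run s
  | loop _ _, s => s

/-- A bound for the number of steps of a program without loops. -/
def RamProg.maxCost : RamProg → ℕ
  | skip => 1
  | assign _ e => e.cost + 1
  | store _ e f => e.cost + f.cost + 1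
  | seq P Q => P.maxCost + Q.maxCost
  | ite e P Q => e.cost + 1 + max P.maxCost Q.maxCost
  | loop _ _ => 0

/-- Within `b` steps, the program `P` started in the state `s` halts in a state with property
`Q`. -/
def RamHalts (P : RamProg) (s : RamState) (b : ℕ) (Q : RamState → Prop) : Prop :=
  ∃ (t : ℕ) (s' : RamState), RamExec P s t s' ∧ t ≤ b ∧ Q s'

theorem RamProg.LoopFree.exec {P : RamProg} (h : P.LoopFree) (s : RamState) :
    ∃ t ≤ P.maxCost, RamExec P s t (P.run s) := by
  induction P generalizing s with
  | skip => exact ⟨_, le_rfl, .skip s⟩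
  | assign i e => exact ⟨_, le_rfl, .assign i e s⟩
  | store a e f => exact ⟨_, le_rfl, .store a e f s⟩
  | seq P Q ihP ihQ =>
    obtain ⟨t, ht, hP⟩ := ihP h.1 s
    obtain ⟨t', ht', hQ⟩ := ihQ h.2 (P.run s)
    exact ⟨t + t', Nat.add_le_add ht ht', hP.seq hQ⟩
  | ite e P Q ihP ihQ =>
    by_cases he : e.eval s = 0
    · obtain ⟨t, ht, hQ⟩ := ihQ h.2 s
      refine ⟨_, ?_, by simpa [RamProg.run, he] using RamExec.ite_false P he hQ⟩
      simp only [RamProg.maxCost]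
      omega
    · obtain ⟨t, ht, hP⟩ := ihP h.1 s
      refine ⟨_, ?_, by simpa [RamProg.run, he] using RamExec.ite_true Q he hP⟩
      simp only [RamProg.maxCost]
      omega
  | loop e P => exact h.elim

theorem RamProg.LoopFree.halts {P : RamProg} (h : P.LoopFree) {s : RamState}
    {Q : RamState → Prop} (hQ : Q (P.run s)) : RamHalts P s P.maxCost Q := by
  obtain ⟨t, ht, hP⟩ := h.exec s
  exact ⟨t, _, hP, ht, hQ⟩

theorem RamHalts.seq {P Q : RamProg} {s : RamState} {a b c : ℕ} {A B : RamState → Prop}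
    (hP : RamHalts P s a A) (hQ : ∀ s', A s' → RamHalts Q s' b B) (hc : a + b ≤ c) :
    RamHalts (.seq P Q) s c B := by
  obtain ⟨t, s', hP, ht, hA⟩ := hP
  obtain ⟨t', s'', hQ, ht', hB⟩ := hQ s' hA
  exact ⟨t + t', s'', hP.seq hQ, by omega, hB⟩

/-- The index of the invariant is a potential that drops in every round, so there are at most `k`
rounds; the summand `1` in `k + 1` pays for the final failing test. -/
theorem RamHalts.loop {P : RamProg} {e : RamExpr} {b : ℕ} (I : ℕ → RamState → Prop)
    (hP : ∀ k s, I k s → e.eval s ≠ 0 → RamHalts P s b fun s' => ∃ k' < k, I k' s') {k : ℕ}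
    {s : RamState} (hs : I k s) :
    RamHalts (.loop e P) s ((k + 1) * (b + e.cost + 1))
      fun s' => ∃ k' ≤ k, I k' s' ∧ e.eval s' = 0 := by
  induction k using Nat.strong_induction_on generalizing s with
  | _ k ih =>
    by_cases he : e.eval s = 0
    · refine ⟨_, _, .loop_false P he, ?_, k, le_rfl, hs, he⟩
      nlinarith [Nat.zero_le (k * (b + e.cost + 1))]
    · obtain ⟨t, s', hexec, ht, k', hk', hI⟩ := hP k s hs he
      obtain ⟨t', s'', hexec', ht', k'', hk'', hs''⟩ := ih k' hk' hI
      refine ⟨_, s'', .loop_true he hexec hexec', ?_, k'', by omega, hs''⟩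
      have : (k' + 1) * (b + e.cost + 1) ≤ k * (b + e.cost + 1) := Nat.mul_le_mul_right _ hk'
      have h2 : (k + 1) * (b + e.cost + 1) = k * (b + e.cost + 1) + (b + e.cost + 1) := by
        ring
      omega

theorem RamProg.LoopFree.halts_loop {P : RamProg} (h : P.LoopFree) {e : RamExpr}
    (I : ℕ → RamState → Prop)
    (hP : ∀ k s, I k s → e.eval s ≠ 0 → ∃ k' < k, I k' (P.run s)) {k : ℕ} {s : RamState}
    (hs : I k s) :
    RamHalts (.loop e P) s ((k + 1) * (P.maxCost + e.cost + 1))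
      fun s' => ∃ k' ≤ k, I k' s' ∧ e.eval s' = 0 :=
  RamHalts.loop I (fun k s hs he => h.halts (hP k s hs he)) hs

theorem IsPathNumber.solves {V : Type*} [Fintype V] {G : Digraph V} {p : ℕ}
    (hp : IsPathNumber G.Adj Finset.univ p) {P : RamProg} {s : RamState} {b : ℕ}
    (h : RamHalts P s b fun s' => s'.reg 0 = (if p = 1 then 1 else 0) ∧ s'.reg 1 = p) :
    SolvesHamiltonianPathWithin P s G b := by
  obtain ⟨t, s', hexec, ht, h₀, h₁⟩ := h
  have hG := hasHamiltonianPath_iff_pathCoverNumber_eq_one G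
  rw [hp.pathCoverNumber_eq] at hG
  refine ⟨t, s', hexec, ht, fun hH => ?_, fun hH => ?_, ?_⟩
  · rw [h₀, if_pos (hG.1 hH)]
  · rw [h₀, if_neg fun h => hH (hG.2 h)]
  · rw [h₁, hp.pathCoverNumber_eq]

/-! ### Expressions for the path number of a composition -/

/-- The number of paths in a minimum path partition of a composition, the parts of which have `a`
and `b` paths and `x` and `y` vertices: for the arcs in neither, one or both directions. -/
def compositionNumber (k : ℕ) (a x b y : ℕ) : ℕ :=
  if k = 0 then a + b else if k = 1 then max a b else max 1 (max (a - y) (b - x))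

/-- The maximum of two expressions. -/
def RamExpr.max (e f : RamExpr) : RamExpr := .add e (.sub f e)

@[simp] theorem RamExpr.eval_max (s : RamState) (e f : RamExpr) :
    (e.max f).eval s = Max.max (e.eval s) (f.eval s) := by
  simp only [RamExpr.max, RamExpr.eval]
  omega

/-- The expression for `compositionNumber`. -/
def RamExpr.composition (k : ℕ) (a x b y : RamExpr) : RamExpr :=
  if k = 0 then .add a b else if k = 1 then a.max b
  else (RamExpr.const 1).max ((RamExpr.sub a y).max (RamExpr.sub b x))

@[simp] theorem RamExpr.eval_composition (s : RamState) (k : ℕ) (a x b y : RamExpr) :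
    (RamExpr.composition k a x b y).eval s =
      compositionNumber k (a.eval s) (x.eval s) (b.eval s) (y.eval s) := by
  unfold RamExpr.composition compositionNumber
  split_ifs <;> simp [RamExpr.eval]

theorem compositionNumber_pos {k a x b y : ℕ} (ha : 1 ≤ a) : 1 ≤ compositionNumber k a x b y := by
  unfold compositionNumber
  split_ifs <;> omega

/-! ### Evaluation of a directed co-expression -/

namespace CoExpr

/-- The path number of the digraph defined by an expression, together with its number of
vertices. -/
def weight {V : Type*} : CoExpr V → ℕ × ℕ
  | vertex _ => (1, 1)
  | union A B => (compositionNumber 0 A.weight.1 A.weight.2 B.weight.1 B.weight.2,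
      A.weight.2 + B.weight.2)
  | order A B => (compositionNumber 1 A.weight.1 A.weight.2 B.weight.1 B.weight.2,
      A.weight.2 + B.weight.2)
  | series A B => (compositionNumber 2 A.weight.1 A.weight.2 B.weight.1 B.weight.2,
      A.weight.2 + B.weight.2)

theorem verts_of_adj {V : Type*} {e : CoExpr V} {u v : V} (h : e.Adj u v) :
    u ∈ e.verts ∧ v ∈ e.verts := by
  induction e with
  | vertex w => exact h.elim
  | union A B ihA ihB =>
    rcases h with h | h
    · exact ⟨Or.inl (ihA h).1, Or.inl (ihA h).2⟩
    · exact ⟨Or.inr (ihB h).1, Or.inr (ihB h).2⟩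
  | order A B ihA ihB =>
    rcases h with h | h | h
    · exact ⟨Or.inl (ihA h).1, Or.inl (ihA h).2⟩
    · exact ⟨Or.inr (ihB h).1, Or.inr (ihB h).2⟩
    · exact ⟨Or.inl h.1, Or.inr h.2⟩
  | series A B ihA ihB =>
    rcases h with h | h | h | h
    · exact ⟨Or.inl (ihA h).1, Or.inl (ihA h).2⟩
    · exact ⟨Or.inr (ihB h).1, Or.inr (ihB h).2⟩
    · exact ⟨Or.inl h.1, Or.inr h.2⟩
    · exact ⟨Or.inr h.1, Or.inl h.2⟩

theorem verts_nonempty {V : Type*} (e : CoExpr V) : e.verts.Nonempty := by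
  induction e with
  | vertex v => exact ⟨v, rfl⟩
  | union A B ihA _ => exact ihA.mono Set.subset_union_left
  | order A B ihA _ => exact ihA.mono Set.subset_union_left
  | series A B ihA _ => exact ihA.mono Set.subset_union_left

end CoExpr

theorem IsPathPartition.congr {V : Type*} {R R' : V → V → Prop} {S : Finset V}
    (hR : ∀ x ∈ S, ∀ y ∈ S, R x y ↔ R' x y) {C : List (List V)} (h : IsPathPartition R S C) :
    IsPathPartition R' S C := by
  have hm : ∀ l ∈ C, ∀ x ∈ l, x ∈ S := fun l hl x hx =>
    (h.mem x).1 (List.mem_flatten.2 ⟨l, hl, hx⟩)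
  refine ⟨h.ne_nil, fun l hl => ?_, h.nodup, h.mem⟩
  exact (h.chain l hl).imp_of_mem_imp fun x y hx hy => (hR x (hm l hl x hx) y (hm l hl y hy)).1

theorem IsPathNumber.congr {V : Type*} {R R' : V → V → Prop} {S : Finset V}
    (hR : ∀ x ∈ S, ∀ y ∈ S, R x y ↔ R' x y) {p : ℕ} (h : IsPathNumber R S p) :
    IsPathNumber R' S p := by
  have hset : {k | ∃ C, IsPathPartition R S C ∧ C.length = k} =
      {k | ∃ C, IsPathPartition R' S C ∧ C.length = k} := by
    ext k
    exact ⟨fun ⟨C, hC, hk⟩ => ⟨C, hC.congr hR, hk⟩,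
      fun ⟨C, hC, hk⟩ => ⟨C, hC.congr fun x hx y hy => (hR x hx y hy).symm, hk⟩⟩
  unfold IsPathNumber at h ⊢
  rwa [← hset]

theorem CoExpr.isPathNumber_weight {V : Type*} {e : CoExpr V} (h : e.VertexDisjoint) :
    ∃ S : Finset V, (S : Set V) = e.verts ∧ S.card = e.weight.2 ∧
      IsPathNumber e.Adj S e.weight.1 := by
  classical
  -- A composition of disjoint parts adds no arcs inside a part, so the path numbers of the parts
  -- may be read in the relation of the whole.
  have key : ∀ (A B e : CoExpr V), Disjoint A.verts B.verts →
      (∀ x ∈ A.verts, ∀ y ∈ A.verts, A.Adj x y ↔ e.Adj x y) →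
      (∀ x ∈ B.verts, ∀ y ∈ B.verts, B.Adj x y ↔ e.Adj x y) →
      (∃ S : Finset V, (S : Set V) = A.verts ∧ S.card = A.weight.2 ∧
        IsPathNumber A.Adj S A.weight.1) →
      (∃ S : Finset V, (S : Set V) = B.verts ∧ S.card = B.weight.2 ∧
        IsPathNumber B.Adj S B.weight.1) →
      ∃ S T : Finset V, (S : Set V) = A.verts ∧ (T : Set V) = B.verts ∧
        Disjoint S T ∧ S.card = A.weight.2 ∧ T.card = B.weight.2 ∧
        IsPathNumber e.Adj S A.weight.1 ∧ IsPathNumber e.Adj T B.weight.1 := by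
    rintro A B e hAB hA hB ⟨S, hS, hSc, hSp⟩ ⟨T, hT, hTc, hTp⟩
    refine ⟨S, T, hS, hT, ?_, hSc, hTc, hSp.congr ?_, hTp.congr ?_⟩
    · rwa [← Finset.disjoint_coe, hS, hT]
    · simpa only [← hS, Finset.mem_coe] using hA
    · simpa only [← hT, Finset.mem_coe] using hB
  induction e with
  | vertex v => exact ⟨{v}, by simp [CoExpr.verts], rfl, isPathNumber_singleton v⟩
  | union A B ihA ihB =>
    obtain ⟨hA, hB, hAB⟩ := h
    have hd := Set.disjoint_left.1 hAB
    obtain ⟨S, T, hS, hT, hST, hSc, hTc, hSp, hTp⟩ := key A B (.union A B) hAB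
      (fun x hx y hy => ⟨Or.inl, fun h => h.resolve_right fun h => hd hx (verts_of_adj h).1⟩)
      (fun x hx y hy => ⟨Or.inr, fun h => h.resolve_left fun h => hd (verts_of_adj h).1 hx⟩)
      (ihA hA) (ihB hB)
    refine ⟨S ∪ T, by simp [hS, hT, CoExpr.verts], ?_, hSp.union hTp hST ?_ ?_⟩
    · rw [Finset.card_union_of_disjoint hST, hSc, hTc]; rfl
    · intro x hx y hy hxy
      rw [← Finset.mem_coe, hS] at hx
      rw [← Finset.mem_coe, hT] at hy
      rcases hxy with h | h
      exacts [hd (verts_of_adj h).2 hy, hd hx (verts_of_adj h).1]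
    · intro x hx y hy hxy
      rw [← Finset.mem_coe, hS] at hx
      rw [← Finset.mem_coe, hT] at hy
      rcases hxy with h | h
      exacts [hd (verts_of_adj h).1 hy, hd hx (verts_of_adj h).2]
  | order A B ihA ihB =>
    obtain ⟨hA, hB, hAB⟩ := h
    have hd := Set.disjoint_left.1 hAB
    obtain ⟨S, T, hS, hT, hST, hSc, hTc, hSp, hTp⟩ := key A B (.order A B) hAB
      (fun x hx y hy => ⟨Or.inl, fun h => h.resolve_right fun h => h.elim
        (fun h => hd hx (verts_of_adj h).1) fun h => hd hy h.2⟩)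
      (fun x hx y hy => ⟨fun h => Or.inr (Or.inl h), fun h => by
        rcases h with h | h | h
        exacts [(hd (verts_of_adj h).1 hx).elim, h, (hd h.1 hx).elim]⟩)
      (ihA hA) (ihB hB)
    refine ⟨S ∪ T, by simp [hS, hT, CoExpr.verts], ?_, hSp.order hTp hST ?_ ?_⟩
    · rw [Finset.card_union_of_disjoint hST, hSc, hTc]; rfl
    · intro x hx y hy
      rw [← Finset.mem_coe, hS] at hx
      rw [← Finset.mem_coe, hT] at hy
      exact Or.inr (Or.inr ⟨hx, hy⟩)
    · intro x hx y hy hxy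
      rw [← Finset.mem_coe, hS] at hx
      rw [← Finset.mem_coe, hT] at hy
      rcases hxy with h | h | h
      exacts [hd (verts_of_adj h).1 hy, hd hx (verts_of_adj h).2, hd h.1 hy]
  | series A B ihA ihB =>
    obtain ⟨hA, hB, hAB⟩ := h
    have hd := Set.disjoint_left.1 hAB
    obtain ⟨S, T, hS, hT, hST, hSc, hTc, hSp, hTp⟩ := key A B (.series A B) hAB
      (fun x hx y hy => ⟨Or.inl, fun h => by
        rcases h with h | h | h | h
        exacts [h, (hd hx (verts_of_adj h).1).elim, (hd hy h.2).elim, (hd hx h.1).elim]⟩)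
      (fun x hx y hy => ⟨fun h => Or.inr (Or.inl h), fun h => by
        rcases h with h | h | h | h
        exacts [(hd (verts_of_adj h).1 hx).elim, h, (hd h.1 hx).elim, (hd h.2 hy).elim]⟩)
      (ihA hA) (ihB hB)
    have hS₀ : S.Nonempty := by
      rw [← Finset.coe_nonempty, hS]; exact A.verts_nonempty
    have hT₀ : T.Nonempty := by
      rw [← Finset.coe_nonempty, hT]; exact B.verts_nonempty
    have hp := hSp.series hTp hS₀ hT₀ hST ?_ ?_
    · rw [hSc, hTc] at hp
      refine ⟨S ∪ T, by simp [hS, hT, CoExpr.verts], ?_, hp⟩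
      rw [Finset.card_union_of_disjoint hST, hSc, hTc]; rfl
    · intro x hx y hy
      rw [← Finset.mem_coe, hS] at hx
      rw [← Finset.mem_coe, hT] at hy
      exact Or.inr (Or.inr (Or.inl ⟨hx, hy⟩))
    · intro x hx y hy
      rw [← Finset.mem_coe, hS] at hx
      rw [← Finset.mem_coe, hT] at hy
      exact Or.inr (Or.inr (Or.inr ⟨hy, hx⟩))

theorem CoExpr.Represents.isPathNumber {V : Type*} [Fintype V] {e : CoExpr V} {G : Digraph V}
    (h : e.Represents G) : IsPathNumber G.Adj Finset.univ e.weight.1 := by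
  obtain ⟨S, hS, -, hp⟩ := e.isPathNumber_weight h.1
  rw [h.2.1, Finset.coe_eq_univ] at hS
  subst hS
  exact hp.congr fun x _ y _ => (h.2.2 x y).symm

theorem CoExpr.one_le_weight {V : Type*} (e : CoExpr V) : 1 ≤ e.weight.1 := by
  induction e with
  | vertex v => exact le_rfl
  | union A B ihA _ =>
    exact compositionNumber_pos (k := 0) (x := A.weight.2) (y := B.weight.2) ihA
  | order A B ihA _ =>
    exact compositionNumber_pos (k := 1) (x := A.weight.2) (y := B.weight.2) ihA
  | series A B ihA _ =>
    exact compositionNumber_pos (k := 2) (x := A.weight.2) (y := B.weight.2) ihA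

/-! ### Postfix words evaluated on a stack -/

/-- One step of the evaluation of a word in postfix notation with a stack of weights. -/
def postfixStep (st : List (ℕ × ℕ)) (c : ℕ) : Option (List (ℕ × ℕ)) :=
  if 2 < c then some ((1, 1) :: st) else
    match st with
    | b :: a :: st => some ((compositionNumber c a.1 a.2 b.1 b.2, a.2 + b.2) :: st)
    | _ => none

theorem postfixStep_of_lt {c : ℕ} (hc : 2 < c) (st : List (ℕ × ℕ)) :
    postfixStep st c = some ((1, 1) :: st) := if_pos hc

theorem postfixStep_of_le {c : ℕ} (hc : c ≤ 2) {st st' : List (ℕ × ℕ)}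
    (h : postfixStep st c = some st') : ∃ a b st₀, st = b :: a :: st₀ ∧
      st' = (compositionNumber c a.1 a.2 b.1 b.2, a.2 + b.2) :: st₀ := by
  match st, h with
  | [], h => simp [postfixStep, hc.not_gt] at h
  | [_], h => simp [postfixStep, hc.not_gt] at h
  | b :: a :: st, h =>
    simp only [postfixStep, hc.not_gt, if_false, Option.some.injEq] at h
    exact ⟨a, b, st, rfl, h.symm⟩

/-- The arbitrary stack `st` below is what lets the induction pass through the second operand, which
is read with the weight of the first already on the stack. -/
theorem CoExpr.foldlM_code {n : ℕ} (e : CoExpr (Fin n)) (st : List (ℕ × ℕ)) :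
    e.code.foldlM postfixStep st = some (e.weight :: st) := by
  induction e generalizing st with
  | vertex v => simp [CoExpr.code, postfixStep, CoExpr.weight]
  | union A B ihA ihB =>
    simp [CoExpr.code, List.foldlM_append, ihA, ihB, postfixStep, CoExpr.weight]
  | order A B ihA ihB =>
    simp [CoExpr.code, List.foldlM_append, ihA, ihB, postfixStep, CoExpr.weight]
  | series A B ihA ihB =>
    simp [CoExpr.code, List.foldlM_append, ihA, ihB, postfixStep, CoExpr.weight]

theorem CoExpr.length_code {n : ℕ} (e : CoExpr (Fin n)) : e.code.length = e.size := by
  induction e with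
  | vertex v => rfl
  | union A B ihA ihB => simp [CoExpr.code, CoExpr.size, ihA, ihB]; omega
  | order A B ihA ihB => simp [CoExpr.code, CoExpr.size, ihA, ihB]; omega
  | series A B ihA ihB => simp [CoExpr.code, CoExpr.size, ihA, ihB]; omega

theorem CoExpr.size_pos {V : Type*} (e : CoExpr V) : 1 ≤ e.size := by
  cases e <;> simp [CoExpr.size]

/-- The arrays `P` and `S` hold the stack `st`, with its top at the highest index. -/
def HoldsStack (P S : ℕ → ℕ) : List (ℕ × ℕ) → Prop
  | [] => True
  | a :: st => P st.length = a.1 ∧ S st.length = a.2 ∧ HoldsStack P S st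

theorem HoldsStack.update {P S : ℕ → ℕ} {st : List (ℕ × ℕ)} (h : HoldsStack P S st) {k : ℕ}
    (hk : st.length ≤ k) (a b : ℕ) :
    HoldsStack (Function.update P k a) (Function.update S k b) st := by
  induction st with
  | nil => trivial
  | cons c st ih =>
    simp only [List.length_cons] at hk
    refine ⟨?_, ?_, ih h.2.2 (by omega)⟩
    · rw [Function.update_of_ne (by omega)]; exact h.1
    · rw [Function.update_of_ne (by omega)]; exact h.2.1

namespace RamProg

/-- The top of the stack, kept in the arrays `1` and `2` with height in register `3`, is combined
with the entry below it. -/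
def combineTop (k : ℕ) : RamProg :=
  .seq (.assign 3 (.sub (.reg 3) (.const 1))) <|
  .seq (.store 1 (.sub (.reg 3) (.const 1))
    (.composition k (.load 1 (.sub (.reg 3) (.const 1))) (.load 2 (.sub (.reg 3) (.const 1)))
      (.load 1 (.reg 3)) (.load 2 (.reg 3)))) <|
  .store 2 (.sub (.reg 3) (.const 1))
    (.add (.load 2 (.sub (.reg 3) (.const 1))) (.load 2 (.reg 3)))

/-- Processes the letter at the position in register `2`. -/
def postfixBody : RamProg :=
  .seq (.ite (.sub (.load 0 (.reg 2)) (.const 2))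
    (.seq (.store 1 (.reg 3) (.const 1)) <| .seq (.store 2 (.reg 3) (.const 1)) <|
      .assign 3 (.add (.reg 3) (.const 1)))
    (.ite (.load 0 (.reg 2))
      (.ite (.sub (.load 0 (.reg 2)) (.const 1)) (combineTop 2) (combineTop 1))
      (combineTop 0))) <|
  .assign 2 (.add (.reg 2) (.const 1))

/-- Evaluates a word in postfix notation. -/
def postfixProg : RamProg :=
  .seq (.loop (.sub (.reg 0) (.reg 2)) postfixBody) <|
  .seq (.assign 1 (.load 1 (.const 0))) <|
  .assign 0 (.sub (.const 1) (.sub (.reg 1) (.const 1)))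

end RamProg

/-- The state of `postfixProg` while it evaluates the word `w` of value `r`. -/
def PostfixInv (w : List ℕ) (r : ℕ × ℕ) (s : RamState) : Prop :=
  s.reg 0 = w.length ∧ s.reg 2 ≤ w.length ∧ (∀ i, s.arr 0 i = w.getD i 0) ∧
  ∃ st, (w.drop (s.reg 2)).foldlM postfixStep st = some [r] ∧ s.reg 3 = st.length ∧
    HoldsStack (s.arr 1) (s.arr 2) st

/-- The invariant only says that the unread letters, applied to the current stack, lead to `r`. One
round therefore peels one letter off the fold, and no subexpression has to be identified. -/
theorem PostfixInv.step {w : List ℕ} {r : ℕ × ℕ} {s : RamState} (h : PostfixInv w r s)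
    (hlt : s.reg 2 < w.length) :
    PostfixInv w r (RamProg.postfixBody.run s) ∧
      w.length - (RamProg.postfixBody.run s).reg 2 < w.length - s.reg 2 := by
  obtain ⟨h₀, h₂, ha, st, hst, h₃, hs⟩ := h
  rw [List.drop_eq_getElem_cons hlt, List.foldlM_cons] at hst
  have hc : s.arr 0 (s.reg 2) = w[s.reg 2] := by
    rw [ha, List.getD_eq_getElem _ _ hlt]
  set c := w[s.reg 2] with hcdef
  have comb : ∀ k, k = c → c ≤ 2 →
      PostfixInv w r ((RamProg.seq (RamProg.combineTop k)
        (.assign 2 (.add (.reg 2) (.const 1)))).run s) ∧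
      w.length - ((RamProg.seq (RamProg.combineTop k)
        (.assign 2 (.add (.reg 2) (.const 1)))).run s).reg 2 < w.length - s.reg 2 := by
    intro k hk hc2
    subst hk
    rw [Option.bind_eq_bind, Option.bind_eq_some_iff] at hst
    obtain ⟨st', hst', hst⟩ := hst
    obtain ⟨a, b, st, rfl, rfl⟩ := postfixStep_of_le hc2 hst'
    obtain ⟨hb₁, hb₂, ha₁, ha₂, hs⟩ := hs
    simp only [List.length_cons] at h₃ hb₁ hb₂
    refine ⟨⟨?_, ?_, ?_,
      (compositionNumber c a.1 a.2 b.1 b.2, a.2 + b.2) :: st, ?_, ?_, ?_⟩, ?_⟩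
    all_goals
      simp [RamProg.run, RamProg.combineTop, RamExpr.eval, h₀, ha, h₃, ha₁, ha₂, hb₁, hb₂,
        HoldsStack]
    · omega
    · exact hst
    · exact hs.update le_rfl _ _
    · omega
  by_cases h2 : 2 < c
  · rw [postfixStep_of_lt h2] at hst
    simp only [Option.bind_eq_bind, Option.bind_some] at hst
    have h2' : c - 2 ≠ 0 := by omega
    refine ⟨⟨?_, ?_, ?_, (1, 1) :: st, ?_, ?_, ?_⟩, ?_⟩
    all_goals
      simp [RamProg.run, RamProg.postfixBody, RamExpr.eval, hc, h2', h₀, h₃, ha, HoldsStack]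
    · omega
    · exact hst
    · exact hs.update le_rfl _ _
    · omega
  · by_cases hc0 : c = 0
    · have := comb 0 hc0.symm (by omega)
      simpa [RamProg.run, RamProg.postfixBody, RamExpr.eval, hc, hc0] using this
    by_cases hc1 : c = 1
    · have := comb 1 hc1.symm (by omega)
      simpa [RamProg.run, RamProg.postfixBody, RamExpr.eval, hc, hc1] using this
    have hc2 : c = 2 := by omega
    have := comb 2 hc2.symm (by omega)
    simpa [RamProg.run, RamProg.postfixBody, RamExpr.eval, hc, hc2] using this

theorem exists_prog_coExpr : ∃ (P : RamProg) (c : ℕ), ∀ (n : ℕ) (G : Digraph (Fin n))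
    (e : CoExpr (Fin n)), e.Represents G →
      SolvesHamiltonianPathWithin P (wordInput e.code) G (c * e.size) := by
  -- A round costs the body plus `4` for the test, at most `e.size + 1 ≤ 2 * e.size` rounds are
  -- charged, and the two final assignments cost `9`.
  refine ⟨RamProg.postfixProg, 2 * (RamProg.postfixBody.maxCost + 4) + 9, fun n G e he => ?_⟩
  refine he.isPathNumber.solves ?_
  have hsize := e.size_pos
  have hloop := RamProg.LoopFree.halts_loop (P := RamProg.postfixBody) (by
      simp [RamProg.postfixBody, RamProg.combineTop, RamProg.LoopFree])
    (e := .sub (.reg 0) (.reg 2))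
    (fun k s => PostfixInv e.code e.weight s ∧ k = e.code.length - s.reg 2)
    (fun k s hs he => by
      obtain ⟨hs, rfl⟩ := hs
      have := hs.1
      simp only [RamExpr.eval] at he
      have := hs.step (by omega)
      exact ⟨_, this.2, this.1, rfl⟩) (s := wordInput e.code)
    ⟨⟨rfl, Nat.zero_le _, fun i => rfl, [], by simpa [wordInput] using e.foldlM_code [], rfl,
      trivial⟩, rfl⟩
  refine hloop.seq (b := 9) (fun s' hs' => ?_) ?_
  · obtain ⟨-, -, ⟨⟨h₀, h₂, -, st, hst, h₃, hs⟩, -⟩, hz⟩ := hs'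
    simp only [RamExpr.eval] at hz
    rw [List.drop_eq_nil_of_le (by omega)] at hst
    simp only [List.foldlM_nil, Option.pure_def, Option.some.injEq] at hst
    subst hst
    -- The answer is computed as `1 - (p - 1)` in truncated subtraction, which would be wrong for `p
    -- = 0`.
    have hw := e.one_le_weight
    have h1 : s'.arr 1 0 = e.weight.1 := hs.1
    obtain ⟨t, s'', h, ht, hQ⟩ := RamProg.LoopFree.halts (P := .seq
      (.assign 1 (.load 1 (.const 0))) (.assign 0 (.sub (.const 1) (.sub (.reg 1) (.const 1)))))
      (s := s')
      (Q := fun s' => s'.reg 0 = (if e.weight.1 = 1 then 1 else 0) ∧ s'.reg 1 = e.weight.1)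
      (by simp [RamProg.LoopFree]) (by
        simp only [RamProg.run, RamExpr.eval, h1]
        refine ⟨?_, by simp⟩
        simp only [Function.update_self]
        split_ifs <;> omega)
    exact ⟨t, s'', h, ht, hQ⟩
  · rw [e.length_code]
    have hr : (wordInput e.code).reg 2 = 0 := rfl
    rw [hr]
    have hcost : (RamExpr.sub (.reg 0) (.reg 2)).cost = 3 := rfl
    rw [hcost]
    generalize RamProg.postfixBody.maxCost = b
    have h2 : (e.size - 0 + 1) * (b + 3 + 1) ≤ (2 * e.size) * (b + 4) :=
      Nat.mul_le_mul (by omega) le_rfl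
    nlinarith

/-! ### Modules and their neighbourhoods -/

section Module

variable {n : ℕ} {G : Digraph (Fin n)}

/-- The vertices outside `K` do not distinguish the vertices of `K`. -/
def IsModuleSet (G : Digraph (Fin n)) (K : Finset (Fin n)) : Prop :=
  ∀ x ∈ K, ∀ y ∈ K, ∀ z ∉ K, (G.Adj x z ↔ G.Adj y z) ∧ (G.Adj z x ↔ G.Adj z y)

/-- The set `S` as a number: the out-neighbour `z` is the digit `z`, the in-neighbour `z` is the
digit `n + z`. -/
def mask (S : Finset (Fin n ⊕ Fin n)) : ℕ :=
  ∑ x ∈ S, 2 ^ Sum.elim (fun z : Fin n => z.val) (fun z : Fin n => n + z.val) x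

/-- Out- and in-neighbours occupy different digits, and binary expansions are unique. So equality of
numbers, which the machine tests by addressing, is equality of neighbourhoods. -/
theorem mask_injective : Function.Injective (mask (n := n)) := by
  set f : Fin n ⊕ Fin n → ℕ := Sum.elim (fun z : Fin n => z.val) (fun z : Fin n => n + z.val)
    with hf
  have hinj : Function.Injective f := by
    rintro (x | x) (y | y) h <;> simp only [hf, Sum.elim_inl, Sum.elim_inr] at h
    · rw [Fin.ext h]
    · omega
    · omega
    · rw [Fin.ext (by omega : x.val = y.val)]
  have hmask : ∀ S, mask S = ∑ k ∈ S.map ⟨f, hinj⟩, 2 ^ k := fun S => by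
    rw [Finset.sum_map]; rfl
  intro S T h
  rw [hmask, hmask] at h
  exact Finset.map_injective _ (Finset.geomSum_injective le_rfl h)

theorem mask_union {S T : Finset (Fin n ⊕ Fin n)} (h : Disjoint S T) :
    mask (S ∪ T) = mask S + mask T := Finset.sum_union h

open Classical in
/-- The out-neighbours and in-neighbours of `K` outside `K`; `K` itself is added to the former if
`a` holds and to the latter if `b` holds. -/
noncomputable def neighbours (G : Digraph (Fin n)) (a b : Bool) (K : Finset (Fin n)) :
    Finset (Fin n ⊕ Fin n) :=
  Finset.univ.filter (Sum.elim (fun z => z ∈ K ∧ a ∨ z ∉ K ∧ ∃ r ∈ K, G.Adj r z)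
    (fun z => z ∈ K ∧ b ∨ z ∉ K ∧ ∃ r ∈ K, G.Adj z r))

theorem mem_neighbours_inl {a b : Bool} {K : Finset (Fin n)} {z : Fin n} :
    Sum.inl z ∈ neighbours G a b K ↔ z ∈ K ∧ a ∨ z ∉ K ∧ ∃ r ∈ K, G.Adj r z := by
  simp [neighbours]

theorem mem_neighbours_inr {a b : Bool} {K : Finset (Fin n)} {z : Fin n} :
    Sum.inr z ∈ neighbours G a b K ↔ z ∈ K ∧ b ∨ z ∉ K ∧ ∃ r ∈ K, G.Adj z r := by
  simp [neighbours]

/-- The number that stands for the neighbourhood of `K`. -/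
noncomputable def key (G : Digraph (Fin n)) (a b : Bool) (K : Finset (Fin n)) : ℕ :=
  mask (neighbours G a b K)

/-- The number that stands for `K` as a set of out-neighbours. -/
def outMask (K : Finset (Fin n)) : ℕ := mask (K.map ⟨Sum.inl, Sum.inl_injective⟩)

/-- The number that stands for `K` as a set of in-neighbours. -/
def inMask (K : Finset (Fin n)) : ℕ := mask (K.map ⟨Sum.inr, Sum.inr_injective⟩)

theorem outMask_singleton (v : Fin n) : outMask {v} = 2 ^ v.val := by simp [outMask, mask]

theorem inMask_singleton (v : Fin n) : inMask {v} = 2 ^ (n + v.val) := by simp [inMask, mask]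

theorem outMask_union {K L : Finset (Fin n)} (h : Disjoint K L) :
    outMask (K ∪ L) = outMask K + outMask L := by
  rw [outMask, Finset.map_union, mask_union (by simpa using h)]; rfl

theorem inMask_union {K L : Finset (Fin n)} (h : Disjoint K L) :
    inMask (K ∪ L) = inMask K + inMask L := by
  rw [inMask, Finset.map_union, mask_union (by simpa using h)]; rfl

/-- The value of `key` computed from the numbers for a set and its neighbourhood. -/
def keyValue (a b : Bool) (k x y : ℕ) : ℕ := k + (if a then x else 0) + (if b then y else 0)

/-- `K` is disjoint from its outside neighbours, so adding it means adding numbers without carry.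
Three stored numbers thus yield all four addresses of a set. -/
theorem key_eq_keyValue (a b : Bool) (K : Finset (Fin n)) :
    key G a b K = keyValue a b (key G false false K) (outMask K) (inMask K) := by
  have ha : ∀ b, key G true b K = key G false b K + outMask K := fun b => by
    rw [key, key, outMask, ← mask_union]
    · congr 1
      ext (z | z) <;> simp [mem_neighbours_inl, mem_neighbours_inr, or_comm]
    · rw [Finset.disjoint_left]
      rintro (z | z) <;> simp [mem_neighbours_inl, mem_neighbours_inr] <;> tauto
  have hb : key G false true K = key G false false K + inMask K := by
    rw [key, key, inMask, ← mask_union]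
    · congr 1
      ext (z | z) <;> simp [mem_neighbours_inl, mem_neighbours_inr, or_comm]
    · rw [Finset.disjoint_left]
      rintro (z | z) <;> simp [mem_neighbours_inl, mem_neighbours_inr] <;> tauto
  cases a <;> cases b <;> simp [keyValue, ha, hb]
  omega

theorem IsModuleSet.adj_iff_exists {K : Finset (Fin n)} (hK : IsModuleSet G K) {x z : Fin n}
    (hx : x ∈ K) (hz : z ∉ K) :
    (G.Adj x z ↔ ∃ r ∈ K, G.Adj r z) ∧ (G.Adj z x ↔ ∃ r ∈ K, G.Adj z r) :=
  ⟨⟨fun h => ⟨x, hx, h⟩, fun ⟨r, hr, h⟩ => ((hK x hx r hr z hz).1).2 h⟩,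
    ⟨fun h => ⟨x, hx, h⟩, fun ⟨r, hr, h⟩ => ((hK x hx r hr z hz).2).2 h⟩⟩

theorem neighbours_iff_of_key_eq {K L : Finset (Fin n)} {a b c d : Bool}
    (h : key G a b K = key G c d L) (z : Fin n) :
    ((z ∈ K ∧ a ∨ z ∉ K ∧ ∃ r ∈ K, G.Adj r z) ↔ (z ∈ L ∧ c ∨ z ∉ L ∧ ∃ r ∈ L, G.Adj r z)) ∧
    ((z ∈ K ∧ b ∨ z ∉ K ∧ ∃ r ∈ K, G.Adj z r) ↔ (z ∈ L ∧ d ∨ z ∉ L ∧ ∃ r ∈ L, G.Adj z r)) := by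
  have h := mask_injective h
  rw [← mem_neighbours_inl (b := b), ← mem_neighbours_inl (b := d),
    ← mem_neighbours_inr (a := a), ← mem_neighbours_inr (a := c), h]
  exact ⟨Iff.rfl, Iff.rfl⟩

/-- Read the equation at a vertex of `L`: on the right it is an out-neighbour exactly if `b` holds
and an in-neighbour exactly if `a` holds. Hence `b` stands for all arcs from `K` to `L` and `a` for
all arcs from `L` to `K`. -/
theorem adj_iff_of_key_eq {K L : Finset (Fin n)} (hK : IsModuleSet G K) (hKL : Disjoint K L)
    {a b : Bool} (h : key G a b K = key G b a L) {x y : Fin n} (hx : x ∈ K) (hy : y ∈ L) :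
    (G.Adj x y ↔ b = true) ∧ (G.Adj y x ↔ a = true) := by
  have hyK : y ∉ K := fun h => Finset.disjoint_left.1 hKL h hy
  have h := neighbours_iff_of_key_eq h y
  rw [(hK.adj_iff_exists hx hyK).1, (hK.adj_iff_exists hx hyK).2]
  simpa [hyK, hy] using h

theorem IsModuleSet.union {K L : Finset (Fin n)} (hK : IsModuleSet G K) (hL : IsModuleSet G L)
    {a b : Bool} (h : key G a b K = key G b a L) : IsModuleSet G (K ∪ L) := by
  have key : ∀ x ∈ K ∪ L, ∀ z ∉ K ∪ L,
      (G.Adj x z ↔ ∃ r ∈ K, G.Adj r z) ∧ (G.Adj z x ↔ ∃ r ∈ K, G.Adj z r) := by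
    intro x hx z hz
    rw [Finset.mem_union, not_or] at hz
    rcases Finset.mem_union.1 hx with hx | hx
    · exact hK.adj_iff_exists hx hz.1
    · have h := neighbours_iff_of_key_eq h z
      rw [(hL.adj_iff_exists hx hz.2).1, (hL.adj_iff_exists hx hz.2).2]
      simpa [hz.1, hz.2, iff_comm] using h
  intro x hx y hy z hz
  rw [(key x hx z hz).1, (key x hx z hz).2, (key y hy z hz).1, (key y hy z hz).2]
  exact ⟨Iff.rfl, Iff.rfl⟩

/-- Twins see the same vertices outside their union, so passing from `K` to `K ∪ L` only removes `L`
from the neighbours of `K`. The number for the union then costs two subtractions. -/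
theorem key_union {K L : Finset (Fin n)} (hK : IsModuleSet G K) (hK₀ : K.Nonempty)
    (hKL : Disjoint K L) {a b : Bool} (h : key G a b K = key G b a L) :
    key G false false K = keyValue b a (key G false false (K ∪ L)) (outMask L) (inMask L) := by
  have hU : ∀ z ∉ K ∪ L, ((∃ r ∈ K ∪ L, G.Adj r z) ↔ ∃ r ∈ K, G.Adj r z) ∧
      ((∃ r ∈ K ∪ L, G.Adj z r) ↔ ∃ r ∈ K, G.Adj z r) := by
    intro z hz
    rw [Finset.mem_union, not_or] at hz
    have h := neighbours_iff_of_key_eq h z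
    simp only [hz.1, hz.2, false_and, not_false_eq_true, true_and, false_or] at h
    simp only [Finset.mem_union, or_and_right, exists_or, ← h.1, ← h.2, or_self, and_self]
  have hL : ∀ z ∈ L, ((∃ r ∈ K, G.Adj r z) ↔ b = true) ∧ ((∃ r ∈ K, G.Adj z r) ↔ a = true) := by
    intro z hz
    obtain ⟨x, hx⟩ := hK₀
    have hzK : z ∉ K := fun h => Finset.disjoint_left.1 hKL h hz
    rw [← (hK.adj_iff_exists hx hzK).1, ← (hK.adj_iff_exists hx hzK).2]
    exact adj_iff_of_key_eq hK hKL h hx hz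
  have hset : neighbours G false false K = neighbours G false false (K ∪ L) ∪
      ((if b then L.map ⟨Sum.inl, Sum.inl_injective⟩ else ∅) ∪
        (if a then L.map ⟨Sum.inr, Sum.inr_injective⟩ else ∅)) := by
    ext (z | z)
    · have h₁ := hU z
      have h₂ := hL z
      have h₃ : z ∈ K → z ∉ L := fun h h' => Finset.disjoint_left.1 hKL h h'
      by_cases hzK : z ∈ K <;> by_cases hzL : z ∈ L <;> cases a <;> cases b <;>
        simp_all [mem_neighbours_inl]
    · have h₁ := hU z
      have h₂ := hL z
      have h₃ : z ∈ K → z ∉ L := fun h h' => Finset.disjoint_left.1 hKL h h'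
      by_cases hzK : z ∈ K <;> by_cases hzL : z ∈ L <;> cases a <;> cases b <;>
        simp_all [mem_neighbours_inr]
  rw [key, hset, mask_union, mask_union]
  · cases a <;> cases b <;> (simp [keyValue, key, outMask, inMask, mask]; try omega)
  · cases a <;> cases b <;> simp [Finset.disjoint_left]
  · rw [Finset.disjoint_left]
    rintro (z | z) <;> cases a <;> cases b <;>
      simp +contextual [mem_neighbours_inl, mem_neighbours_inr]

/-- If, say, only `b` holds, then every `x ∈ K` has an arc to some `r ∈ L`. This `r` is an
out-neighbour of `K`, but `L` is not added to its own out-neighbours. So sets in the same mixed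
table never collide. -/
theorem key_ne_of_disjoint {K L : Finset (Fin n)} (hK₀ : K.Nonempty) (hL₀ : L.Nonempty)
    (hKL : Disjoint K L) {a b : Bool} (hab : a ≠ b) : key G a b K ≠ key G a b L := by
  intro h
  have hd : ∀ z ∈ K, z ∉ L := fun z h h' => Finset.disjoint_left.1 hKL h h'
  have hd' : ∀ z ∈ L, z ∉ K := fun z h h' => Finset.disjoint_left.1 hKL h' h
  obtain ⟨x, hx⟩ := hK₀
  obtain ⟨y, hy⟩ := hL₀
  have h := neighbours_iff_of_key_eq h
  cases a <;> cases b
  · exact hab rfl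
  · have h₁ := (h x).2
    simp only [hx, hd x hx, true_and, not_true_eq_false, false_and, or_false, false_or,
      not_false_eq_true, true_iff] at h₁
    obtain ⟨r, hr, hxr⟩ := h₁
    have h₂ := (h r).1
    simp only [hr, hd' r hr, true_and, not_true_eq_false, false_and, or_false, false_or,
      not_false_eq_true, Bool.false_eq_true, iff_false] at h₂
    exact h₂ ⟨x, hx, hxr⟩
  · have h₁ := (h x).1
    simp only [hx, hd x hx, true_and, not_true_eq_false, false_and, or_false, false_or,
      not_false_eq_true, true_iff] at h₁
    obtain ⟨r, hr, hxr⟩ := h₁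
    have h₂ := (h r).2
    simp only [hr, hd' r hr, true_and, not_true_eq_false, false_and, or_false, false_or,
      not_false_eq_true, Bool.false_eq_true, iff_false] at h₂
    exact h₂ ⟨x, hx, hxr⟩
  · exact hab rfl

theorem IsPathNumber.of_key_eq {K L : Finset (Fin n)} (hK : IsModuleSet G K)
    (hK₀ : K.Nonempty) (hL₀ : L.Nonempty) (hKL : Disjoint K L) {a b : Bool}
    (h : key G a b K = key G b a L) {p q : ℕ} (hp : IsPathNumber G.Adj K p)
    (hq : IsPathNumber G.Adj L q) :
    IsPathNumber G.Adj (K ∪ L) (compositionNumber (a.toNat + b.toNat) p K.card q L.card) := by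
  have hadj := fun x hx y hy => adj_iff_of_key_eq hK hKL h (x := x) (y := y) hx hy
  cases a <;> cases b
  · exact hp.union hq hKL (fun x hx y hy => by simpa using (hadj x hx y hy).1)
      fun x hx y hy => by simpa using (hadj x hx y hy).2
  · exact hp.order hq hKL (fun x hx y hy => by simpa using (hadj x hx y hy).1)
      fun x hx y hy => by simpa using (hadj x hx y hy).2
  -- Arcs only from `L` to `K` give the order composition with exchanged parts; its formula is
  -- symmetric, so counting directions suffices.
  · have := hq.order hp hKL.symm (fun y hy x hx => by simpa using (hadj x hx y hy).2)
      fun y hy x hx => by simpa using (hadj x hx y hy).1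
    rw [Finset.union_comm, max_comm] at this
    exact this
  · exact hp.series hq hK₀ hL₀ hKL (fun x hx y hy => by simpa using (hadj x hx y hy).1)
      fun x hx y hy => by simpa using (hadj x hx y hy).2

end Module

/-! ### Twins in directed co-graphs -/

/-- A vertex of one operand does not distinguish the vertices of the other, so twins within one side
of `S` are twins in `S`. Working with subsets `S` avoids expressions for induced subgraphs. -/
theorem CoExpr.exists_twins {V : Type*} {e : CoExpr V} (he : e.VertexDisjoint) (S : Finset V)
    (hS : ∀ x ∈ S, x ∈ e.verts) (hcard : 2 ≤ S.card) :
    ∃ u ∈ S, ∃ v ∈ S, u ≠ v ∧ ∀ w ∈ S, w ≠ u → w ≠ v →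
      (e.Adj u w ↔ e.Adj v w) ∧ (e.Adj w u ↔ e.Adj w v) := by
  classical
  have key : ∀ (A B e : CoExpr V) (S : Finset V),
      (∀ T : Finset V, (∀ x ∈ T, x ∈ A.verts) → 2 ≤ T.card →
        ∃ u ∈ T, ∃ v ∈ T, u ≠ v ∧ ∀ w ∈ T, w ≠ u → w ≠ v →
          (A.Adj u w ↔ A.Adj v w) ∧ (A.Adj w u ↔ A.Adj w v)) →
      (∀ T : Finset V, (∀ x ∈ T, x ∈ B.verts) → 2 ≤ T.card →
        ∃ u ∈ T, ∃ v ∈ T, u ≠ v ∧ ∀ w ∈ T, w ≠ u → w ≠ v →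
          (B.Adj u w ↔ B.Adj v w) ∧ (B.Adj w u ↔ B.Adj w v)) →
      (∀ x ∈ S, x ∈ A.verts ∨ x ∈ B.verts) → 2 ≤ S.card →
      (∀ x ∈ A.verts, ∀ y ∈ A.verts, (e.Adj x y ↔ A.Adj x y)) →
      (∀ x ∈ B.verts, ∀ y ∈ B.verts, (e.Adj x y ↔ B.Adj x y)) →
      (∀ x ∈ A.verts, ∀ y ∈ A.verts, ∀ z ∈ B.verts,
        (e.Adj x z ↔ e.Adj y z) ∧ (e.Adj z x ↔ e.Adj z y)) →
      (∀ x ∈ B.verts, ∀ y ∈ B.verts, ∀ z ∈ A.verts,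
        (e.Adj x z ↔ e.Adj y z) ∧ (e.Adj z x ↔ e.Adj z y)) →
      ∃ u ∈ S, ∃ v ∈ S, u ≠ v ∧ ∀ w ∈ S, w ≠ u → w ≠ v →
        (e.Adj u w ↔ e.Adj v w) ∧ (e.Adj w u ↔ e.Adj w v) := by
    intro A B e S ihA ihB hS hcard hA hB hAB hBA
    have side : ∀ (A B : CoExpr V),
        (∀ T : Finset V, (∀ x ∈ T, x ∈ A.verts) → 2 ≤ T.card →
          ∃ u ∈ T, ∃ v ∈ T, u ≠ v ∧ ∀ w ∈ T, w ≠ u → w ≠ v →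
            (A.Adj u w ↔ A.Adj v w) ∧ (A.Adj w u ↔ A.Adj w v)) →
        (∀ x ∈ S, x ∈ A.verts ∨ x ∈ B.verts) →
        (∀ x ∈ A.verts, ∀ y ∈ A.verts, (e.Adj x y ↔ A.Adj x y)) →
        (∀ x ∈ A.verts, ∀ y ∈ A.verts, ∀ z ∈ B.verts,
          (e.Adj x z ↔ e.Adj y z) ∧ (e.Adj z x ↔ e.Adj z y)) →
        2 ≤ (S.filter (· ∈ A.verts)).card →
        ∃ u ∈ S, ∃ v ∈ S, u ≠ v ∧ ∀ w ∈ S, w ≠ u → w ≠ v →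
          (e.Adj u w ↔ e.Adj v w) ∧ (e.Adj w u ↔ e.Adj w v) := by
      intro A B ihA hS hA hAB h2
      obtain ⟨u, hu, v, hv, huv, h⟩ := ihA (S.filter (· ∈ A.verts))
        (fun x hx => (Finset.mem_filter.1 hx).2) h2
      rw [Finset.mem_filter] at hu hv
      refine ⟨u, hu.1, v, hv.1, huv, fun w hw hwu hwv => ?_⟩
      rcases em (w ∈ A.verts) with hwA | hwA
      · rw [hA u hu.2 w hwA, hA v hv.2 w hwA, hA w hwA u hu.2, hA w hwA v hv.2]
        exact h w (Finset.mem_filter.2 ⟨hw, hwA⟩) hwu hwv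
      · exact hAB u hu.2 v hv.2 w ((hS w hw).resolve_left hwA)
    by_cases h2 : 2 ≤ (S.filter (· ∈ A.verts)).card
    · exact side A B ihA hS hA hAB h2
    by_cases h2' : 2 ≤ (S.filter (· ∈ B.verts)).card
    · exact side B A ihB (fun x hx => (hS x hx).symm) hB hBA h2'
    -- Otherwise each side contributes at most one vertex, so `S` is a pair and there is no third
    -- vertex to compare with.
    have hcov : S ⊆ S.filter (· ∈ A.verts) ∪ S.filter (· ∈ B.verts) := fun x hx => by
      simpa [hx] using hS x hx
    have hle := (Finset.card_le_card hcov).trans (Finset.card_union_le _ _)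
    have hS2 : S.card = 2 := by omega
    obtain ⟨u, v, huv, rfl⟩ := Finset.card_eq_two.1 hS2
    refine ⟨u, by simp, v, by simp, huv, fun w hw hwu hwv => ?_⟩
    simp [hwu, hwv] at hw
  induction e generalizing S with
  | vertex v =>
    have : S ⊆ {v} := fun x hx => Finset.mem_singleton.2 (hS x hx)
    have := Finset.card_le_card this
    simp only [Finset.card_singleton] at this
    omega
  | union A B ihA ihB =>
    have hd := Set.disjoint_left.1 he.2.2
    have hv := fun (e : CoExpr V) (u v : V) (h : e.Adj u v) => verts_of_adj h
    refine key A B _ S (ihA he.1) (ihB he.2.1) hS hcard ?_ ?_ ?_ ?_ <;>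
      simp only [CoExpr.Adj] <;> intros <;> grind
  | order A B ihA ihB =>
    have hd := Set.disjoint_left.1 he.2.2
    have hv := fun (e : CoExpr V) (u v : V) (h : e.Adj u v) => verts_of_adj h
    refine key A B _ S (ihA he.1) (ihB he.2.1) hS hcard ?_ ?_ ?_ ?_ <;>
      simp only [CoExpr.Adj] <;> intros <;> grind
  | series A B ihA ihB =>
    have hd := Set.disjoint_left.1 he.2.2
    have hv := fun (e : CoExpr V) (u v : V) (h : e.Adj u v) => verts_of_adj h
    refine key A B _ S (ihA he.1) (ihB he.2.1) hS hcard ?_ ?_ ?_ ?_ <;>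
      simp only [CoExpr.Adj] <;> intros <;> grind

theorem CoExpr.not_adj_self {V : Type*} {e : CoExpr V} (he : e.VertexDisjoint) (v : V) :
    ¬ e.Adj v v := by
  induction e with
  | vertex w => exact id
  | union A B ihA ihB => exact not_or.2 ⟨ihA he.1, ihB he.2.1⟩
  | order A B ihA ihB =>
    have hd := Set.disjoint_left.1 he.2.2
    rintro (h | h | h)
    exacts [ihA he.1 h, ihB he.2.1 h, hd h.1 h.2]
  | series A B ihA ihB =>
    have hd := Set.disjoint_left.1 he.2.2
    rintro (h | h | h | h)
    exacts [ihA he.1 h, ihB he.2.1 h, hd h.1 h.2, hd h.2 h.1]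

/-- If the vertices of a directed co-graph are partitioned into at least two modules, then two of
the modules have the same neighbourhood apart from the arcs between them. -/
theorem IsDirectedCograph.exists_key_eq {n : ℕ} {G : Digraph (Fin n)} (hG : IsDirectedCograph G)
    {R : Finset ℕ} {K : ℕ → Finset (Fin n)} (hK : ∀ j ∈ R, IsModuleSet G (K j))
    (hK₀ : ∀ j ∈ R, (K j).Nonempty) (hd : ∀ j ∈ R, ∀ k ∈ R, j ≠ k → Disjoint (K j) (K k))
    (hcov : ∀ z, ∃ j ∈ R, z ∈ K j) (hR : 2 ≤ R.card) :
    ∃ j ∈ R, ∃ k ∈ R, j ≠ k ∧ ∃ a b, key G a b (K j) = key G b a (K k) := by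
  classical
  obtain ⟨e, he, hverts, hadj⟩ := hG
  have : Nonempty (Fin n) := ⟨e.verts_nonempty.some⟩
  -- One representative per module: between different modules adjacency depends on the
  -- representatives only, so twins among these give twin modules.
  choose! r hr using hK₀
  have hinj : Set.InjOn r R := by
    intro j hj k hk hjk
    by_contra hne
    exact Finset.disjoint_left.1 (hd j hj k hk hne) (hr j hj) (hjk ▸ hr k hk)
  obtain ⟨u, hu, v, hv, huv, h⟩ := e.exists_twins he (R.image r)
    (fun x _ => by rw [hverts]; trivial) (by rwa [Finset.card_image_of_injOn hinj])
  obtain ⟨j, hj, rfl⟩ := Finset.mem_image.1 hu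
  obtain ⟨k, hk, rfl⟩ := Finset.mem_image.1 hv
  have hjk : j ≠ k := fun h => huv (h ▸ rfl)
  simp only [← hadj] at h
  have hnot : ∀ i ∈ R, ∀ i' ∈ R, i ≠ i' → ∀ z ∈ K i', z ∉ K i := fun i hi i' hi' hne z hz hz' =>
    Finset.disjoint_left.1 (hd i hi i' hi' hne) hz' hz
  -- As in `adj_iff_of_key_eq`, the first flag records arcs from `K k` to `K j`, the second those
  -- from `K j` to `K k`.
  refine ⟨j, hj, k, hk, hjk, decide (G.Adj (r k) (r j)), decide (G.Adj (r j) (r k)), ?_⟩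
  rw [key, key]
  congr 1
  have out : ∀ i ∈ R, ∀ z ∉ K i, ((∃ x ∈ K i, G.Adj x z) ↔ G.Adj (r i) z) ∧
      ((∃ x ∈ K i, G.Adj z x) ↔ G.Adj z (r i)) := fun i hi z hz =>
    ⟨((hK i hi).adj_iff_exists (hr i hi) hz).1.symm,
      ((hK i hi).adj_iff_exists (hr i hi) hz).2.symm⟩
  have rep : ∀ i ∈ R, ∀ z ∈ K i, ∀ x ∉ K i, (G.Adj x z ↔ G.Adj x (r i)) ∧
      (G.Adj z x ↔ G.Adj (r i) x) := fun i hi z hz x hx =>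
    ⟨(hK i hi z hz (r i) (hr i hi) x hx).2, (hK i hi z hz (r i) (hr i hi) x hx).1⟩
  have main : ∀ z, ((z ∈ K j ∧ G.Adj (r k) (r j) ∨ z ∉ K j ∧ ∃ x ∈ K j, G.Adj x z) ↔
      (z ∈ K k ∧ G.Adj (r j) (r k) ∨ z ∉ K k ∧ ∃ x ∈ K k, G.Adj x z)) ∧
      ((z ∈ K j ∧ G.Adj (r j) (r k) ∨ z ∉ K j ∧ ∃ x ∈ K j, G.Adj z x) ↔
      (z ∈ K k ∧ G.Adj (r k) (r j) ∨ z ∉ K k ∧ ∃ x ∈ K k, G.Adj z x)) := by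
    intro z
    obtain ⟨i, hi, hz⟩ := hcov z
    have hrk := hnot j hj k hk hjk (r k) (hr k hk)
    have hrj := hnot k hk j hj hjk.symm (r j) (hr j hj)
    by_cases hij : i = j
    · subst hij
      have hzk := hnot k hk i hj hjk.symm z hz
      simp only [hz, hzk, true_and, not_true_eq_false, false_and, or_false, false_or,
        not_false_eq_true, (out k hk z hzk).1, (out k hk z hzk).2]
      exact ⟨((rep i hj z hz (r k) hrk).1).symm, ((rep i hj z hz (r k) hrk).2).symm⟩
    by_cases hik : i = k
    · subst hik
      have hzj := hnot j hj i hk hjk z hz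
      simp only [hz, hzj, true_and, not_true_eq_false, false_and, or_false, false_or,
        not_false_eq_true, (out j hj z hzj).1, (out j hj z hzj).2]
      exact ⟨(rep i hk z hz (r j) hrj).1, (rep i hk z hz (r j) hrj).2⟩
    have hzj := hnot j hj i hi (Ne.symm hij) z hz
    have hzk := hnot k hk i hi (Ne.symm hik) z hz
    simp only [hzj, hzk, false_and, false_or, not_false_eq_true, true_and, (out j hj z hzj).1,
      (out j hj z hzj).2, (out k hk z hzk).1, (out k hk z hzk).2]
    have hrji := hnot i hi j hj hij (r j) (hr j hj)
    have hrki := hnot i hi k hk hik (r k) (hr k hk)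
    rw [(rep i hi z hz _ hrji).1, (rep i hi z hz _ hrji).2, (rep i hi z hz _ hrki).1,
      (rep i hi z hz _ hrki).2]
    exact h (r i) (Finset.mem_image_of_mem r hi)
      (fun hne => hij (hinj hi hj hne)) (fun hne => hik (hinj hi hk hne))
  ext (z | z)
  · rw [mem_neighbours_inl, mem_neighbours_inl]
    simpa only [decide_eq_true_eq] using (main z).1
  · rw [mem_neighbours_inr, mem_neighbours_inr]
    simpa only [decide_eq_true_eq] using (main z).2

/-! ### The neighbourhoods of the vertices -/

/-- The contribution of the arc `x` to the number for the neighbourhood of `v`. -/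
def arcKey {n : ℕ} (v : ℕ) (x : Fin n × Fin n) : ℕ :=
  (if x.1.val = v then 2 ^ x.2.val else 0) + (if x.2.val = v then 2 ^ (n + x.1.val) else 0)

/-- Each arc is listed once, so no digit is added twice; without loops, no vertex is its own
neighbour. -/
theorem ListsArcs.sum_arcKey {n : ℕ} {G : Digraph (Fin n)} {l : List (Fin n × Fin n)}
    (hl : ListsArcs G l) (hG : ∀ v, ¬ G.Adj v v) (v : Fin n) :
    (l.map (arcKey v.val)).sum = key G false false {v} := by
  classical
  have hfin : l.toFinset = Finset.univ.filter fun x : Fin n × Fin n => G.Adj x.1 x.2 := by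
    ext x
    simpa using hl.2 x.1 x.2
  rw [← List.sum_toFinset _ hl.1, hfin, Finset.sum_filter, Fintype.sum_prod_type]
  rw [key, mask, neighbours, Finset.sum_filter, Fintype.sum_sum_type]
  have hne : ∀ z, G.Adj v z → z ≠ v := fun z h e => hG v (e ▸ h)
  have hne' : ∀ z, G.Adj z v → z ≠ v := fun z h e => hG v (e ▸ h)
  have h₁ : ∀ x y : Fin n, (if G.Adj x y then arcKey v.val (x, y) else 0) =
      (if x = v then (if G.Adj v y then 2 ^ y.val else 0) else 0) +
      (if y = v then (if G.Adj x v then 2 ^ (n + x.val) else 0) else 0) := by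
    intro x y
    simp only [arcKey, ← Fin.ext_iff]
    by_cases hx : x = v <;> by_cases hy : y = v <;> by_cases hxy : G.Adj x y <;> simp_all
  simp only [h₁, Finset.sum_add_distrib]
  congr 1
  · rw [Finset.sum_comm]
    refine Finset.sum_congr rfl fun z _ => ?_
    rw [Finset.sum_ite_eq' Finset.univ v]
    have := hne z
    by_cases hz : G.Adj v z <;> simp_all
  · refine Finset.sum_congr rfl fun z _ => ?_
    rw [Finset.sum_ite_eq' Finset.univ v]
    have := hne' z
    by_cases hz : G.Adj z v <;> simp_all

/-! ### Contracting twins -/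

/-- The table in which a set is registered under its number `key G a b`. -/
def tableIndex : Bool → Bool → ℕ
  | false, false => 9
  | true, false => 10
  | false, true => 11
  | true, true => 12

/-- The expression for `keyValue`. -/
def RamExpr.keyValue : Bool → Bool → RamExpr → RamExpr → RamExpr → RamExpr
  | false, false, k, _, _ => k
  | true, false, k, x, _ => .add k x
  | false, true, k, _, y => .add k y
  | true, true, k, x, y => .add (.add k x) y

@[simp] theorem RamExpr.eval_keyValue (s : RamState) (a b : Bool) (k x y : RamExpr) :
    (RamExpr.keyValue a b k x y).eval s = _root_.keyValue a b (k.eval s) (x.eval s) (y.eval s) := by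
  cases a <;> cases b <;> simp [RamExpr.keyValue, RamExpr.eval, _root_.keyValue]

namespace RamProg

/-- Stores the value of `e` in the four tables at the numbers for a set. -/
def storeTables (k x y e : RamExpr) : RamProg :=
  .seq (.store 9 (.keyValue false false k x y) e) <|
  .seq (.store 10 (.keyValue true false k x y) e) <|
  .seq (.store 11 (.keyValue false true k x y) e) <|
  .store 12 (.keyValue true true k x y) e

/-- Contracts the current set, kept in the registers `4` to `8`, with its twin, kept in the arrays
`4` to `8` at the index in register `9`. -/
def contract (a b : Bool) : RamProg :=
  .seq (.assign 7 (.composition (a.toNat + b.toNat) (.reg 7) (.reg 8) (.load 7 (.reg 9))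
    (.load 8 (.reg 9)))) <|
  .seq (.assign 8 (.add (.reg 8) (.load 8 (.reg 9)))) <|
  .seq (.assign 4 (.sub (.sub (.reg 4) (if b then .load 5 (.reg 9) else .const 0))
    (if a then .load 6 (.reg 9) else .const 0))) <|
  .seq (.assign 5 (.add (.reg 5) (.load 5 (.reg 9)))) <|
  .seq (.assign 6 (.add (.reg 6) (.load 6 (.reg 9)))) <|
  storeTables (.load 4 (.reg 9)) (.load 5 (.reg 9)) (.load 6 (.reg 9)) (.const 0)

/-- Makes the vertex in register `2` the current set. -/
def loadVertex : RamProg :=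
  .seq (.assign 4 (.load 3 (.reg 2))) <|
  .seq (.assign 5 (.load 2 (.reg 2))) <|
  .seq (.assign 6 (.load 2 (.add (.reg 0) (.reg 2)))) <|
  .seq (.assign 7 (.const 1)) <|
  .assign 8 (.const 1)

/-- Registers the current set and goes on to the next vertex. -/
def register : RamProg :=
  .seq (.assign 2 (.add (.reg 2) (.const 1))) <|
  .seq (.store 4 (.reg 2) (.reg 4)) <|
  .seq (.store 5 (.reg 2) (.reg 5)) <|
  .seq (.store 6 (.reg 2) (.reg 6)) <|
  .seq (.store 7 (.reg 2) (.reg 7)) <|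
  .seq (.store 8 (.reg 2) (.reg 8)) <|
  .seq (storeTables (.reg 4) (.reg 5) (.reg 6) (.reg 2)) loadVertex

/-- Contracts the current set with a twin of the given kind, if there is one, and runs `P`
otherwise. -/
def tryContract (a b : Bool) (P : RamProg) : RamProg :=
  .seq (.assign 9 (.load (tableIndex b a) (.keyValue a b (.reg 4) (.reg 5) (.reg 6)))) <|
  .ite (.reg 9) (contract a b) P

/-- Contracts the current set with a twin or registers it. -/
def contractBody : RamProg :=
  tryContract false false <| tryContract true false <| tryContract false true <|
    tryContract true true register

end RamProg

/-- The numbers `k`, `x`, `y`, `p`, `c` describe the module `K`. -/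
structure DescribesModule {n : ℕ} (G : Digraph (Fin n)) (K : Finset (Fin n))
    (k x y p c : ℕ) : Prop where
  isModule : IsModuleSet G K
  nonempty : K.Nonempty
  key_eq : key G false false K = k
  out_eq : outMask K = x
  in_eq : inMask K = y
  isPathNumber : IsPathNumber G.Adj K p
  card_eq : K.card = c

theorem describesModule_singleton {n : ℕ} (G : Digraph (Fin n)) (v : Fin n) :
    DescribesModule G {v} (key G false false {v}) (2 ^ v.val) (2 ^ (n + v.val)) 1 1 where
  isModule := by
    intro x hx y hy z _
    rw [Finset.mem_singleton.1 hx, Finset.mem_singleton.1 hy]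
    exact ⟨Iff.rfl, Iff.rfl⟩
  nonempty := ⟨v, by simp⟩
  key_eq := rfl
  out_eq := outMask_singleton v
  in_eq := inMask_singleton v
  isPathNumber := isPathNumber_singleton v
  card_eq := by simp

theorem DescribesModule.key_eq_keyValue {n : ℕ} {G : Digraph (Fin n)} {K : Finset (Fin n)}
    {k x y p c : ℕ} (h : DescribesModule G K k x y p c) (a b : Bool) :
    key G a b K = keyValue a b k x y := by
  rw [_root_.key_eq_keyValue, h.key_eq, h.out_eq, h.in_eq]

theorem DescribesModule.union {n : ℕ} {G : Digraph (Fin n)} {K L : Finset (Fin n)}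
    {k x y p c k' x' y' p' c' : ℕ} (hK : DescribesModule G K k x y p c)
    (hL : DescribesModule G L k' x' y' p' c') (hKL : Disjoint K L) {a b : Bool}
    (h : key G a b K = key G b a L) :
    DescribesModule G (K ∪ L) (k - (if b then x' else 0) - (if a then y' else 0)) (x + x')
      (y + y') (compositionNumber (a.toNat + b.toNat) p c p' c') (c + c') where
  isModule := hK.isModule.union hL.isModule h
  nonempty := hK.nonempty.mono Finset.subset_union_left
  key_eq := by
    have := key_union hK.isModule hK.nonempty hKL h
    rw [hK.key_eq, hL.out_eq, hL.in_eq] at this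
    rw [this, keyValue]
    omega
  out_eq := by rw [outMask_union hKL, hK.out_eq, hL.out_eq]
  in_eq := by rw [inMask_union hKL, hK.in_eq, hL.in_eq]
  isPathNumber := by
    have := hK.isPathNumber.of_key_eq hK.isModule hK.nonempty hL.nonempty hKL h hL.isPathNumber
    rwa [hK.card_eq, hL.card_eq] at this
  card_eq := by rw [Finset.card_union_of_disjoint hKL, hK.card_eq, hL.card_eq]

/-- The state of the program while it contracts twins: the modules `K j` with `j ∈ R` are
registered, no two of them are twins, and `C` is the current module. Together they contain the
vertices up to `v`. -/
structure ContractionState {n : ℕ} (G : Digraph (Fin n)) (v : ℕ) (R : Finset ℕ)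
    (K : ℕ → Finset (Fin n)) (C : Finset (Fin n)) (s : RamState) : Prop where
  reg_zero : s.reg 0 = n
  reg_two : s.reg 2 = v
  le : v ≤ n
  arr_two : ∀ i < 2 * n, s.arr 2 i = 2 ^ i
  arr_three : ∀ u : Fin n, s.arr 3 u = key G false false {u}
  index : ∀ j ∈ R, 1 ≤ j ∧ j ≤ v
  registered : ∀ j ∈ R,
    DescribesModule G (K j) (s.arr 4 j) (s.arr 5 j) (s.arr 6 j) (s.arr 7 j) (s.arr 8 j)
  current : v < n → DescribesModule G C (s.reg 4) (s.reg 5) (s.reg 6) (s.reg 7) (s.reg 8)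
  disjoint : ∀ j ∈ R, ∀ k ∈ R, j ≠ k → Disjoint (K j) (K k)
  disjoint_current : ∀ j ∈ R, Disjoint C (K j)
  cover : ∀ z : Fin n, z.val ≤ v ↔ z ∈ C ∨ ∃ j ∈ R, z ∈ K j
  table : ∀ a b x j, j ≠ 0 → (s.arr (tableIndex a b) x = j ↔ j ∈ R ∧ key G a b (K j) = x)
  not_twins : ∀ j ∈ R, ∀ k ∈ R, j ≠ k → ∀ a b, key G a b (K j) ≠ key G b a (K k)
  finished : v = n → C = ∅ ∧ n ∈ R

/-! ### The contraction invariant, its preservation and its termination -/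

section Contraction

variable {n : ℕ} {G : Digraph (Fin n)} {v : ℕ} {R : Finset ℕ} {K : ℕ → Finset (Fin n)}
  {C : Finset (Fin n)} {s : RamState}

/-- The program is executed symbolically once, so that the proof about the invariant need not unfold
it. -/
theorem RamProg.run_contract (a b : Bool) (s : RamState) :
    ∃ s', (RamProg.contract a b).run s = s' ∧ s'.reg 0 = s.reg 0 ∧ s'.reg 2 = s.reg 2 ∧
      (∀ i < 9, s'.arr i = s.arr i) ∧
      s'.reg 4 = s.reg 4 - (if b then s.arr 5 (s.reg 9) else 0) -
        (if a then s.arr 6 (s.reg 9) else 0) ∧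
      s'.reg 5 = s.reg 5 + s.arr 5 (s.reg 9) ∧ s'.reg 6 = s.reg 6 + s.arr 6 (s.reg 9) ∧
      s'.reg 7 = compositionNumber (a.toNat + b.toNat) (s.reg 7) (s.reg 8) (s.arr 7 (s.reg 9))
        (s.arr 8 (s.reg 9)) ∧
      s'.reg 8 = s.reg 8 + s.arr 8 (s.reg 9) ∧
      ∀ c d, s'.arr (tableIndex c d) = Function.update (s.arr (tableIndex c d))
        (keyValue c d (s.arr 4 (s.reg 9)) (s.arr 5 (s.reg 9)) (s.arr 6 (s.reg 9))) 0 := by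
  refine ⟨_, rfl, ?_⟩
  have hlt : ∀ i < 9, i ≠ 9 ∧ i ≠ 10 ∧ i ≠ 11 ∧ i ≠ 12 := fun i hi => by omega
  refine ⟨?_, ?_, ?_, ?_, ?_, ?_, ?_, ?_, ?_⟩
  · simp [run, contract, storeTables]
  · simp [run, contract, storeTables]
  · intro i hi
    simp [run, contract, storeTables, hlt i hi]
  · cases a <;> cases b <;> simp [run, contract, storeTables, RamExpr.eval]
  · simp [run, contract, storeTables, RamExpr.eval]
  · simp [run, contract, storeTables, RamExpr.eval]
  · simp [run, contract, storeTables, RamExpr.eval]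
  · simp [run, contract, storeTables, RamExpr.eval]
  · intro c d
    cases c <;> cases d <;> simp [run, contract, storeTables, RamExpr.eval, tableIndex]

theorem RamProg.run_register (s : RamState) :
    ∃ s', RamProg.register.run s = s' ∧ s'.reg 0 = s.reg 0 ∧ s'.reg 2 = s.reg 2 + 1 ∧
      s'.arr 2 = s.arr 2 ∧ s'.arr 3 = s.arr 3 ∧
      s'.arr 4 = Function.update (s.arr 4) (s.reg 2 + 1) (s.reg 4) ∧
      s'.arr 5 = Function.update (s.arr 5) (s.reg 2 + 1) (s.reg 5) ∧
      s'.arr 6 = Function.update (s.arr 6) (s.reg 2 + 1) (s.reg 6) ∧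
      s'.arr 7 = Function.update (s.arr 7) (s.reg 2 + 1) (s.reg 7) ∧
      s'.arr 8 = Function.update (s.arr 8) (s.reg 2 + 1) (s.reg 8) ∧
      (∀ c d, s'.arr (tableIndex c d) = Function.update (s.arr (tableIndex c d))
        (keyValue c d (s.reg 4) (s.reg 5) (s.reg 6)) (s.reg 2 + 1)) ∧
      s'.reg 4 = s.arr 3 (s.reg 2 + 1) ∧ s'.reg 5 = s.arr 2 (s.reg 2 + 1) ∧
      s'.reg 6 = s.arr 2 (s.reg 0 + (s.reg 2 + 1)) ∧ s'.reg 7 = 1 ∧ s'.reg 8 = 1 := by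
  refine ⟨_, rfl, ?_⟩
  refine ⟨?_, ?_, ?_, ?_, ?_, ?_, ?_, ?_, ?_, ?_, ?_, ?_, ?_, ?_, ?_⟩
  case refine_10 =>
    intro c d
    cases c <;> cases d <;>
      simp [run, register, storeTables, loadVertex, RamExpr.eval, tableIndex]
  all_goals simp [run, register, storeTables, loadVertex, RamExpr.eval]

theorem ContractionState.update_nine (h : ContractionState G v R K C s) (x : ℕ) :
    ContractionState G v R K C { s with reg := Function.update s.reg 9 x } where
  reg_zero := by simpa using h.reg_zero
  reg_two := by simpa using h.reg_two
  le := h.le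
  arr_two := h.arr_two
  arr_three := h.arr_three
  index := h.index
  registered := h.registered
  current := by simpa using h.current
  disjoint := h.disjoint
  disjoint_current := h.disjoint_current
  cover := h.cover
  table := h.table
  not_twins := h.not_twins
  finished := h.finished

/-- A table cell holds only one index. Hence clearing the cells of one registered set does not erase
another. -/
theorem ContractionState.key_injOn (h : ContractionState G v R K C s) {j k : ℕ} (hj : j ∈ R)
    (hk : k ∈ R) {a b : Bool} (hjk : key G a b (K j) = key G a b (K k)) : j = k := by
  have hj' := h.index j hj
  have hk' := h.index k hk
  have h₁ := (h.table a b _ j (by omega)).2 ⟨hj, hjk⟩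
  have h₂ := (h.table a b _ k (by omega)).2 ⟨hk, rfl⟩
  exact h₁.symm.trans h₂

theorem ContractionState.contract (h : ContractionState G v R K C s) (hv : v < n) {r : ℕ}
    (hr : r ∈ R) (hreg : s.reg 9 = r) {a b : Bool} (hkey : key G a b C = key G b a (K r)) :
    ContractionState G v (R.erase r) K (C ∪ K r) ((RamProg.contract a b).run s) := by
  obtain ⟨s', hs', h0, h2, harr, h4, h5, h6, h7, h8, htab⟩ := RamProg.run_contract a b s
  rw [hs']
  rw [hreg] at h4 h5 h6 h7 h8 htab
  have hR := h.registered r hr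
  refine ⟨by rw [h0, h.reg_zero], by rw [h2, h.reg_two], h.le, ?_, ?_, ?_, ?_, ?_, ?_, ?_, ?_, ?_,
    ?_, ?_⟩
  · rw [harr 2 (by omega)]; exact h.arr_two
  · rw [harr 3 (by omega)]; exact h.arr_three
  · exact fun j hj => h.index j (Finset.mem_of_mem_erase hj)
  · rw [harr 4 (by omega), harr 5 (by omega), harr 6 (by omega), harr 7 (by omega),
      harr 8 (by omega)]
    exact fun j hj => h.registered j (Finset.mem_of_mem_erase hj)
  · intro _
    rw [h4, h5, h6, h7, h8]
    exact (h.current hv).union hR (h.disjoint_current r hr) hkey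
  · exact fun j hj k hk => h.disjoint j (Finset.mem_of_mem_erase hj) k (Finset.mem_of_mem_erase hk)
  · intro j hj
    rw [Finset.mem_erase] at hj
    exact Finset.disjoint_union_left.2 ⟨h.disjoint_current j hj.2, h.disjoint r hr j hj.2 hj.1.symm⟩
  · intro z
    rw [h.cover z, Finset.mem_union, or_assoc]
    refine or_congr_right ⟨?_, ?_⟩
    · rintro ⟨j, hj, hz⟩
      by_cases hjr : j = r
      · exact Or.inl (hjr ▸ hz)
      · exact Or.inr ⟨j, Finset.mem_erase.2 ⟨hjr, hj⟩, hz⟩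
    · rintro (hz | ⟨j, hj, hz⟩)
      · exact ⟨r, hr, hz⟩
      · exact ⟨j, Finset.mem_of_mem_erase hj, hz⟩
  · intro c d x j hj
    rw [htab, ← hR.key_eq_keyValue, Function.update_apply, Finset.mem_erase]
    split_ifs with hx
    · refine ⟨fun h => (hj h.symm).elim, fun ⟨⟨hjr, hjR⟩, hjx⟩ => ?_⟩
      exact (hjr (h.key_injOn hjR hr (hjx.trans hx))).elim
    · rw [h.table c d x j hj, and_assoc]
      refine ⟨fun ⟨hjR, hjx⟩ => ⟨?_, hjR, hjx⟩, fun h => h.2⟩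
      rintro rfl
      exact hx hjx.symm
  · exact fun j hj k hk =>
      h.not_twins j (Finset.mem_of_mem_erase hj) k (Finset.mem_of_mem_erase hk)
  · omega

/-- The set that began with vertex `v` gets the index `v + 1`. It is new, since earlier indices are
at most `v`, and it is not `0`, which marks an empty cell. After the last vertex the current set is
empty and the numbers loaded for it are meaningless. -/
theorem ContractionState.register (h : ContractionState G v R K C s) (hv : v < n)
    (hnot : ∀ j ∈ R, ∀ a b, key G a b C ≠ key G b a (K j)) :
    ContractionState G (v + 1) (insert (v + 1) R) (Function.update K (v + 1) C)
      (if hv : v + 1 < n then {⟨v + 1, hv⟩} else ∅) (RamProg.register.run s) := by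
  obtain ⟨s', hs', h0, h2, ha2, ha3, ha4, ha5, ha6, ha7, ha8, htab, h4, h5, h6, h7, h8⟩ :=
    RamProg.run_register s
  rw [hs']
  rw [h.reg_two] at h2 ha4 ha5 ha6 ha7 ha8 htab h4 h5 h6
  rw [h.reg_zero] at h6
  have hC := h.current hv
  have hRv : ∀ j ∈ R, j ≠ v + 1 := fun j hj => by have := h.index j hj; omega
  have hKj : ∀ j ∈ R, Function.update K (v + 1) C j = K j := fun j hj =>
    Function.update_of_ne (hRv j hj) _ _
  have hKv : Function.update K (v + 1) C (v + 1) = C := Function.update_self _ _ _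
  have hle : ∀ z : Fin n, (z ∈ C ∨ ∃ j ∈ R, z ∈ K j) ↔ z.val ≤ v := fun z => (h.cover z).symm
  have hdis : ∀ j ∈ insert (v + 1) R,
      ∀ z ∈ Function.update K (v + 1) C j, z.val ≤ v := by
    intro j hj z hz
    rcases Finset.mem_insert.1 hj with rfl | hj
    · rw [hKv] at hz
      exact (hle z).1 (Or.inl hz)
    · rw [hKj j hj] at hz
      exact (hle z).1 (Or.inr ⟨j, hj, hz⟩)
  refine ⟨by rw [h0, h.reg_zero], h2, hv, ?_, ?_, ?_, ?_, ?_, ?_, ?_, ?_, ?_, ?_, ?_⟩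
  · rw [ha2]; exact h.arr_two
  · rw [ha3]; exact h.arr_three
  · intro j hj
    rcases Finset.mem_insert.1 hj with rfl | hj
    · omega
    · have := h.index j hj
      omega
  · intro j hj
    rw [ha4, ha5, ha6, ha7, ha8]
    rcases Finset.mem_insert.1 hj with rfl | hj
    · simpa only [Function.update_self] using hC
    · simpa only [Function.update_of_ne (hRv j hj)] using h.registered j hj
  · intro hv'
    rw [dif_pos hv', h4, h5, h6, h7, h8, h.arr_two _ (by omega), h.arr_two _ (by omega),
      h.arr_three ⟨v + 1, hv'⟩]
    exact describesModule_singleton G ⟨v + 1, hv'⟩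
  · intro j hj k hk hjk
    rcases Finset.mem_insert.1 hj with rfl | hj <;> rcases Finset.mem_insert.1 hk with rfl | hk
    · exact (hjk rfl).elim
    · rw [hKv, hKj k hk]; exact h.disjoint_current k hk
    · rw [hKv, hKj j hj]; exact (h.disjoint_current j hj).symm
    · rw [hKj j hj, hKj k hk]; exact h.disjoint j hj k hk hjk
  · intro j hj
    split_ifs with hv'
    · rw [Finset.disjoint_singleton_left]
      intro hz
      have := hdis j hj _ hz
      simp only at this
      omega
    · exact Finset.disjoint_empty_left _
  · intro z
    have hz : (∃ j ∈ insert (v + 1) R, z ∈ Function.update K (v + 1) C j) ↔ z.val ≤ v := by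
      rw [← hle z]
      constructor
      · rintro ⟨j, hj, hz⟩
        rw [hle]
        exact hdis j hj z hz
      · rintro (hz | ⟨j, hj, hz⟩)
        · exact ⟨v + 1, Finset.mem_insert_self _ _, by rwa [hKv]⟩
        · exact ⟨j, Finset.mem_insert_of_mem hj, by rwa [hKj j hj]⟩
    rw [hz]
    split_ifs with hv'
    · rw [Finset.mem_singleton, Fin.ext_iff]
      simp only
      omega
    · have := z.isLt
      simp only [Finset.notMem_empty, false_or]
      omega
  · intro c d x j hj
    rw [htab, ← hC.key_eq_keyValue, Function.update_apply]
    split_ifs with hx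
    · subst hx
      constructor
      · rintro rfl
        exact ⟨Finset.mem_insert_self _ _, by rw [hKv]⟩
      · rintro ⟨hjR, hjx⟩
        rcases Finset.mem_insert.1 hjR with rfl | hjR
        · rfl
        · exfalso
          rw [hKj j hjR] at hjx
          -- The cell written now cannot belong to an older set: with equal flags that set would be
          -- a twin of `C`, and with different flags disjoint sets never share a number.
          by_cases hcd : c = d
          · subst hcd
            exact hnot j hjR c c hjx.symm
          · exact key_ne_of_disjoint (h.registered j hjR).nonempty hC.nonempty
              (h.disjoint_current j hjR).symm hcd hjx
    · rw [h.table c d x j hj]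
      constructor
      · rintro ⟨hjR, hjx⟩
        exact ⟨Finset.mem_insert_of_mem hjR, by rwa [hKj j hjR]⟩
      · rintro ⟨hjR, hjx⟩
        rcases Finset.mem_insert.1 hjR with rfl | hjR
        · rw [hKv] at hjx
          exact (hx hjx.symm).elim
        · exact ⟨hjR, by rwa [hKj j hjR] at hjx⟩
  · intro j hj k hk hjk a b
    rcases Finset.mem_insert.1 hj with rfl | hj <;> rcases Finset.mem_insert.1 hk with rfl | hk
    · exact (hjk rfl).elim
    · rw [hKv, hKj k hk]; exact hnot k hk a b
    · rw [hKv, hKj j hj]; exact (hnot j hj b a).symm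
    · rw [hKj j hj, hKj k hk]; exact h.not_twins j hj k hk hjk a b
  · rintro rfl
    exact ⟨dif_neg (lt_irrefl _), Finset.mem_insert_self _ _⟩

/-- The program is in a state of the contraction in which `k` bounds the number of iterations that
are left. -/
def IsContracting (G : Digraph (Fin n)) (k : ℕ) (s : RamState) : Prop :=
  ∃ v R K C, ContractionState G v R K C s ∧ k = 2 * (n - v) + R.card

/-- A twin with flags `a b` seen from `C` is registered with the flags exchanged, hence the lookup
in table `b a`. An empty cell proves that there is no such twin. -/
theorem ContractionState.tryContract (h : ContractionState G v R K C s) (hv : v < n)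
    {a b : Bool} {P : RamProg}
    (hP : ∀ s', ContractionState G v R K C s' → (∀ j ∈ R, key G a b C ≠ key G b a (K j)) →
      ∃ k < 2 * (n - v) + R.card, IsContracting G k (P.run s')) :
    ∃ k < 2 * (n - v) + R.card, IsContracting G k ((RamProg.tryContract a b P).run s) := by
  have hC := h.current hv
  simp only [RamProg.tryContract, RamProg.run, RamExpr.eval, RamExpr.eval_keyValue,
    ← hC.key_eq_keyValue, Function.update_self]
  set r := s.arr (tableIndex b a) (key G a b C) with hr
  split_ifs with hr0
  · obtain ⟨hrR, hkey⟩ := (h.table b a _ r hr0).1 hr.symm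
    have := (h.update_nine r).contract hv hrR (by simp) hkey.symm
    refine ⟨_, ?_, v, _, _, _, this, rfl⟩
    have := Finset.card_erase_lt_of_mem hrR
    omega
  · refine hP _ (h.update_nine r) fun j hj hkey => ?_
    have hj0 : j ≠ 0 := by have := h.index j hj; omega
    have := (h.table b a _ j hj0).2 ⟨hj, hkey.symm⟩
    rw [← hr] at this
    exact hr0 fun h => hj0 (this.symm.trans h)

/-- Contracting lowers `R.card` by one; registering raises it by at most one but lowers `2 * (n -
v)` by two. -/
theorem IsContracting.step {k : ℕ} (h : IsContracting G k s) (hs : s.reg 2 < n) :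
    ∃ k' < k, IsContracting G k' (RamProg.contractBody.run s) := by
  obtain ⟨v, R, K, C, h, rfl⟩ := h
  rw [h.reg_two] at hs
  refine h.tryContract hs fun s₁ h₁ hn₁ => h₁.tryContract hs fun s₂ h₂ hn₂ =>
    h₂.tryContract hs fun s₃ h₃ hn₃ => h₃.tryContract hs fun s₄ h₄ hn₄ => ?_
  refine ⟨_, ?_, _, _, _, _, h₄.register hs ?_, rfl⟩
  · have := Finset.card_insert_le (v + 1) R
    omega
  · intro j hj a b
    cases a <;> cases b
    exacts [hn₁ j hj, hn₃ j hj, hn₂ j hj, hn₄ j hj]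

/-- At the end the registered modules cover all vertices without twins, so there is only one. Its
index is `n`, the last one given. -/
theorem IsContracting.exists_isPathNumber {k : ℕ} (h : IsContracting G k s) (hs : n ≤ s.reg 2)
    (hG : IsDirectedCograph G) : IsPathNumber G.Adj Finset.univ (s.arr 7 n) := by
  obtain ⟨v, R, K, C, h, -⟩ := h
  have hv : v = n := le_antisymm h.le (h.reg_two ▸ hs)
  subst hv
  obtain ⟨rfl, hn⟩ := h.finished rfl
  have hcov : ∀ z, ∃ j ∈ R, z ∈ K j := fun z => by
    simpa using (h.cover z).1 z.isLt.le
  have hcard : R.card < 2 := by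
    by_contra! hcon
    obtain ⟨j, hj, k, hk, hjk, a, b, hab⟩ := hG.exists_key_eq
      (fun j hj => (h.registered j hj).isModule) (fun j hj => (h.registered j hj).nonempty)
      h.disjoint hcov hcon
    exact h.not_twins j hj k hk hjk a b hab
  have huniv : K v = Finset.univ := by
    refine Finset.eq_univ_of_forall fun z => ?_
    obtain ⟨j, hj, hz⟩ := hcov z
    exact Finset.card_le_one.1 (Nat.le_of_lt_succ hcard) j hj v hn ▸ hz
  exact huniv ▸ (h.registered v hn).isPathNumber

end Contraction

/-! ### The complete program for arc lists: initialisation, phases and running time -/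

namespace RamProg

/-- Stores a power of two in array `2`. -/
def powerBody : RamProg :=
  .seq (.store 2 (.reg 2) (.reg 3)) <|
  .seq (.assign 3 (.add (.reg 3) (.reg 3))) <|
  .assign 2 (.add (.reg 2) (.const 1))

/-- Adds an arc to the neighbourhoods in array `3`. -/
def arcBody : RamProg :=
  .seq (.store 3 (.load 0 (.reg 2))
    (.add (.load 3 (.load 0 (.reg 2))) (.load 2 (.load 1 (.reg 2))))) <|
  .seq (.store 3 (.load 1 (.reg 2))
    (.add (.load 3 (.load 1 (.reg 2))) (.load 2 (.add (.reg 0) (.load 0 (.reg 2)))))) <|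
  .assign 2 (.add (.reg 2) (.const 1))

/-- The path number of a directed co-graph, given by its arcs. The neighbourhoods of the vertices
are kept as numbers of up to `2 * n` binary digits, twins are found by using these numbers as
addresses, and every pair of twins that is found is contracted. -/
def digraphProg : RamProg :=
  .seq (.assign 3 (.const 1)) <|
  .seq (.loop (.sub (.add (.reg 0) (.reg 0)) (.reg 2)) powerBody) <|
  .seq (.assign 2 (.const 0)) <|
  .seq (.loop (.sub (.reg 1) (.reg 2)) arcBody) <|
  .seq (.seq (.assign 2 (.const 0)) loadVertex) <|
  .seq (.loop (.sub (.reg 0) (.reg 2)) contractBody) <|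
  .seq (.assign 1 (.load 7 (.reg 0))) <|
  .assign 0 (.sub (.const 1) (.sub (.reg 1) (.const 1)))

end RamProg

section Digraph

variable {n : ℕ} {G : Digraph (Fin n)} {l : List (Fin n × Fin n)} {s : RamState}

/-- The state of the program while it computes powers of two. -/
structure PowerState (l : List (Fin n × Fin n)) (s : RamState) : Prop where
  reg_zero : s.reg 0 = n
  reg_one : s.reg 1 = l.length
  le : s.reg 2 ≤ 2 * n
  reg_three : s.reg 3 = 2 ^ s.reg 2
  arr_zero : ∀ i, s.arr 0 i = (l.map fun x => x.1.val).getD i 0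
  arr_one : ∀ i, s.arr 1 i = (l.map fun x => x.2.val).getD i 0
  arr_two : ∀ i < s.reg 2, s.arr 2 i = 2 ^ i
  arr_zero_of_le : ∀ a, 3 ≤ a → ∀ i, s.arr a i = 0

theorem PowerState.step (h : PowerState l s) (hs : s.reg 2 < 2 * n) :
    PowerState l (RamProg.powerBody.run s) ∧ (RamProg.powerBody.run s).reg 2 = s.reg 2 + 1 := by
  have h3 : ∀ a, 3 ≤ a → a ≠ 2 := fun a ha => by omega
  refine ⟨⟨?_, ?_, ?_, ?_, ?_, ?_, ?_, ?_⟩, ?_⟩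
  · simpa [RamProg.run, RamProg.powerBody] using h.reg_zero
  · simpa [RamProg.run, RamProg.powerBody] using h.reg_one
  · simpa [RamProg.run, RamProg.powerBody, RamExpr.eval] using hs
  · simp [RamProg.run, RamProg.powerBody, RamExpr.eval, h.reg_three, pow_succ, mul_two]
  · simpa [RamProg.run, RamProg.powerBody] using h.arr_zero
  · simpa [RamProg.run, RamProg.powerBody] using h.arr_one
  · intro i hi
    have h2 : (RamProg.powerBody.run s).reg 2 = s.reg 2 + 1 := by
      simp [RamProg.run, RamProg.powerBody, RamExpr.eval]
    rw [h2] at hi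
    simp only [RamProg.run, RamProg.powerBody, RamExpr.eval, Function.update_self]
    rw [Function.update_apply]
    split_ifs with hi'
    · rw [hi', h.reg_three]
    · exact h.arr_two i (by omega)
  · intro a ha i
    simpa [RamProg.run, RamProg.powerBody, h3 a ha] using h.arr_zero_of_le a ha i
  · simp [RamProg.run, RamProg.powerBody, RamExpr.eval]

/-- The state of the program while it computes the neighbourhoods. -/
structure ArcState (l : List (Fin n × Fin n)) (s : RamState) : Prop where
  reg_zero : s.reg 0 = n
  reg_one : s.reg 1 = l.length
  le : s.reg 2 ≤ l.length
  arr_zero : ∀ i, s.arr 0 i = (l.map fun x => x.1.val).getD i 0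
  arr_one : ∀ i, s.arr 1 i = (l.map fun x => x.2.val).getD i 0
  arr_two : ∀ i < 2 * n, s.arr 2 i = 2 ^ i
  arr_three : ∀ v, s.arr 3 v = ((l.take (s.reg 2)).map (arcKey v)).sum
  arr_zero_of_le : ∀ a, 4 ≤ a → ∀ i, s.arr a i = 0

theorem ArcState.step (h : ArcState l s) (hs : s.reg 2 < l.length) :
    ArcState l (RamProg.arcBody.run s) ∧ (RamProg.arcBody.run s).reg 2 = s.reg 2 + 1 := by
  have h3 : ∀ a, 4 ≤ a → a ≠ 3 := fun a ha => by omega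
  have h0 : s.arr 0 (s.reg 2) = (l[s.reg 2]).1.val := by
    rw [h.arr_zero, List.getD_eq_getElem _ _ (by simpa using hs), List.getElem_map]
  have h1 : s.arr 1 (s.reg 2) = (l[s.reg 2]).2.val := by
    rw [h.arr_one, List.getD_eq_getElem _ _ (by simpa using hs), List.getElem_map]
  refine ⟨⟨?_, ?_, ?_, ?_, ?_, ?_, ?_, ?_⟩, ?_⟩
  · simpa [RamProg.run, RamProg.arcBody] using h.reg_zero
  · simpa [RamProg.run, RamProg.arcBody] using h.reg_one
  · simpa [RamProg.run, RamProg.arcBody, RamExpr.eval] using hs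
  · simpa [RamProg.run, RamProg.arcBody] using h.arr_zero
  · simpa [RamProg.run, RamProg.arcBody] using h.arr_one
  · simpa [RamProg.run, RamProg.arcBody] using h.arr_two
  · intro v
    have h2 := h.arr_two (l[s.reg 2]).2.val (by omega)
    have h2' := h.arr_two (n + (l[s.reg 2]).1.val) (by omega)
    simp only [RamProg.run, RamProg.arcBody, RamExpr.eval, Function.update_self]
    simp only [Function.update_of_ne (show (0 : ℕ) ≠ 3 by omega),
      Function.update_of_ne (show (1 : ℕ) ≠ 3 by omega),
      Function.update_of_ne (show (2 : ℕ) ≠ 3 by omega), h0, h1, h2, h2', h.reg_zero]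
    rw [List.take_add_one, List.getElem?_eq_getElem hs, List.map_append, List.sum_append,
      ← h.arr_three v]
    simp only [Option.toList_some, List.map_cons, List.map_nil, List.sum_singleton, arcKey,
      Function.update_apply, eq_comm (a := v)]
    split_ifs <;> simp_all [add_assoc]
  · intro a ha i
    simpa [RamProg.run, RamProg.arcBody, h3 a ha] using h.arr_zero_of_le a ha i
  · simp [RamProg.run, RamProg.arcBody, RamExpr.eval]

/-- The potential starts at `2 * n`: vertex `0` is the current set and nothing is registered. -/
theorem ArcState.isContracting (h : ArcState l s) (hs : l.length ≤ s.reg 2)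
    (hl : ListsArcs G l) (hG : ∀ v, ¬ G.Adj v v) (hn : 0 < n) :
    IsContracting G (2 * n) ((RamProg.seq (.assign 2 (.const 0)) RamProg.loadVertex).run s) := by
  have h3 : ∀ v : Fin n, s.arr 3 v = key G false false {v} := fun v => by
    rw [h.arr_three, List.take_of_length_le hs, hl.sum_arcKey hG]
  refine ⟨0, ∅, fun _ => ∅, {⟨0, hn⟩}, ⟨?_, ?_, Nat.zero_le n, ?_, ?_, by simp, by simp, ?_,
    by simp, by simp, ?_, ?_, by simp, by omega⟩, by simp⟩
  · simpa [RamProg.run, RamProg.loadVertex] using h.reg_zero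
  · simp [RamProg.run, RamProg.loadVertex, RamExpr.eval]
  · simpa [RamProg.run, RamProg.loadVertex] using h.arr_two
  · simpa [RamProg.run, RamProg.loadVertex] using h3
  · intro _
    have h30 := h3 ⟨0, hn⟩
    have := describesModule_singleton G ⟨0, hn⟩
    simpa [RamProg.run, RamProg.loadVertex, RamExpr.eval, h30, h.reg_zero,
      h.arr_two 0 (by omega), h.arr_two n (by omega)] using this
  · intro z
    simp [Fin.ext_iff]
  · intro a b x j hj
    have : 4 ≤ tableIndex a b := by cases a <;> cases b <;> simp [tableIndex]
    simp [RamProg.run, RamProg.loadVertex, h.arr_zero_of_le _ this, hj.symm]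

theorem exists_prog_digraph : ∃ (P : RamProg) (c : ℕ), ∀ (n : ℕ) (G : Digraph (Fin n))
    (l : List (Fin n × Fin n)), IsDirectedCograph G → ListsArcs G l →
      SolvesHamiltonianPathWithin P (digraphInput n l) G (c * (n + l.length)) := by
  -- The costs of the loop bodies stay opaque; it only matters that they do not depend on the input.
  obtain ⟨x, hx⟩ : ∃ x, RamProg.powerBody.maxCost = x := ⟨_, rfl⟩
  obtain ⟨y, hy⟩ : ∃ y, RamProg.arcBody.maxCost = y := ⟨_, rfl⟩
  obtain ⟨z, hz⟩ : ∃ z, RamProg.contractBody.maxCost = z := ⟨_, rfl⟩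
  refine ⟨RamProg.digraphProg, 3 * (x + 6) + (y + 4) + 3 * (z + 4) + 100,
    fun n G l hG hl => ?_⟩
  obtain ⟨e, he⟩ := id hG
  have hp := he.isPathNumber
  have hloop : ∀ v, ¬ G.Adj v v := fun v h => e.not_adj_self he.1 v ((he.2.2 v v).1 h)
  have hn : 0 < n := by
    obtain ⟨v, -⟩ := e.verts_nonempty
    exact v.pos
  refine hp.solves ?_
  have hpow : ∀ s, PowerState l s ∧ s.reg 2 = 0 → RamHalts _ s _ _ := fun s hs =>
    RamProg.LoopFree.halts_loop (P := RamProg.powerBody) (by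
      simp [RamProg.powerBody, RamProg.LoopFree])
    (e := .sub (.add (.reg 0) (.reg 0)) (.reg 2))
    (fun k s => PowerState l s ∧ k = 2 * n - s.reg 2)
    (fun k s hs he => by
      obtain ⟨hs, rfl⟩ := hs
      have := hs.reg_zero
      simp only [RamExpr.eval] at he
      obtain ⟨h₁, h₂⟩ := hs.step (by omega)
      exact ⟨_, by omega, h₁, rfl⟩) (k := 2 * n) ⟨hs.1, by omega⟩
  have harc : ∀ s, ArcState l s ∧ s.reg 2 = 0 → RamHalts _ s _ _ := fun s hs =>
    RamProg.LoopFree.halts_loop (P := RamProg.arcBody) (by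
      simp [RamProg.arcBody, RamProg.LoopFree])
    (e := .sub (.reg 1) (.reg 2))
    (fun k s => ArcState l s ∧ k = l.length - s.reg 2)
    (fun k s hs he => by
      obtain ⟨hs, rfl⟩ := hs
      have := hs.reg_one
      simp only [RamExpr.eval] at he
      obtain ⟨h₁, h₂⟩ := hs.step (by omega)
      exact ⟨_, by omega, h₁, rfl⟩) (k := l.length) ⟨hs.1, by omega⟩
  have hcon : ∀ s, IsContracting G (2 * n) s ∧ s.reg 0 = n → RamHalts _ s _ _ := fun s hs =>
    RamProg.LoopFree.halts_loop (P := RamProg.contractBody) (by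
      simp [RamProg.contractBody, RamProg.tryContract, RamProg.register, RamProg.contract,
        RamProg.storeTables, RamProg.loadVertex, RamProg.LoopFree])
    (e := .sub (.reg 0) (.reg 2)) (fun k s => IsContracting G k s)
    (fun k s hs he => by
      have h0 : s.reg 0 = n := by
        obtain ⟨_, _, _, _, h, _⟩ := hs
        exact h.reg_zero
      simp only [RamExpr.eval] at he
      exact hs.step (by omega)) hs.1
  have hlast : ∀ s, (∃ k ≤ 2 * n, IsContracting G k s ∧
      (RamExpr.sub (.reg 0) (.reg 2)).eval s = 0) → RamHalts _ s _ _ := fun s hs =>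
    RamProg.LoopFree.halts (P := .seq (.assign 1 (.load 7 (.reg 0)))
      (.assign 0 (.sub (.const 1) (.sub (.reg 1) (.const 1)))))
    (Q := fun s => s.reg 0 = (if e.weight.1 = 1 then 1 else 0) ∧ s.reg 1 = e.weight.1)
    (by simp [RamProg.LoopFree]) (by
      obtain ⟨k, -, hs, hz⟩ := hs
      have h0 : s.reg 0 = n := by
        obtain ⟨_, _, _, _, h, _⟩ := hs
        exact h.reg_zero
      simp only [RamExpr.eval] at hz
      have h7 : s.arr 7 n = e.weight.1 :=
        (hs.exists_isPathNumber (by omega) hG).unique hp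
      have hw := e.one_le_weight
      simp only [RamProg.run, RamExpr.eval, h0, h7]
      refine ⟨?_, by simp⟩
      simp only [Function.update_self]
      split_ifs <;> omega)
  -- The phases are composed from the last to the first, with time bounds left to unification and
  -- estimated only at the end.
  have h6 := fun s hs => (hcon s hs).seq hlast le_rfl
  have h5 : ∀ s, ArcState l s ∧ l.length ≤ s.reg 2 → RamHalts _ s _ _ := fun s hs =>
    (RamProg.LoopFree.halts (P := .seq (.assign 2 (.const 0)) RamProg.loadVertex)
      (by simp [RamProg.loadVertex, RamProg.LoopFree])
      (Q := fun s => IsContracting G (2 * n) s ∧ s.reg 0 = n)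
      ⟨hs.1.isContracting hs.2 hl hloop hn, by
        simpa [RamProg.run, RamProg.loadVertex] using hs.1.reg_zero⟩).seq h6 le_rfl
  have h4 := fun s hs => (harc s hs).seq (fun s' hs' => h5 s' (by
    obtain ⟨k, -, ⟨hs', -⟩, hz⟩ := hs'
    have := hs'.reg_one
    simp only [RamExpr.eval] at hz
    exact ⟨hs', by omega⟩)) le_rfl
  have h3 : ∀ s, PowerState l s ∧ 2 * n ≤ s.reg 2 → RamHalts _ s _ _ := fun s hs =>
    (RamProg.LoopFree.halts (P := .assign 2 (.const 0)) trivial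
      (Q := fun s => ArcState l s ∧ s.reg 2 = 0) (by
        obtain ⟨hs, hle⟩ := hs
        refine ⟨⟨?_, ?_, ?_, hs.arr_zero, hs.arr_one, ?_, ?_, ?_⟩, ?_⟩
        · simpa [RamProg.run] using hs.reg_zero
        · simpa [RamProg.run] using hs.reg_one
        · simp [RamProg.run, RamExpr.eval]
        · exact fun i hi => hs.arr_two i (by omega)
        · intro v
          simpa [RamProg.run, RamExpr.eval] using hs.arr_zero_of_le 3 le_rfl v
        · exact fun a ha => hs.arr_zero_of_le a (by omega)
        · simp [RamProg.run, RamExpr.eval])).seq h4 le_rfl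
  have h2 := fun s hs => (hpow s hs).seq (fun s' hs' => h3 s' (by
    obtain ⟨k, -, ⟨hs', -⟩, hz⟩ := hs'
    have := hs'.reg_zero
    simp only [RamExpr.eval] at hz
    exact ⟨hs', by omega⟩)) le_rfl
  refine RamHalts.seq (RamProg.LoopFree.halts (P := .assign 3 (.const 1)) trivial
    (Q := fun s => PowerState l s ∧ s.reg 2 = 0) ?_) h2 ?_
  · refine ⟨⟨?_, ?_, ?_, ?_, ?_, ?_, ?_, ?_⟩, ?_⟩
    · simp [RamProg.run, digraphInput]
    · simp [RamProg.run, digraphInput]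
    · simp [RamProg.run, digraphInput]
    · simp [RamProg.run, digraphInput, RamExpr.eval]
    · intro i
      simp [RamProg.run, digraphInput]
    · intro i
      simp [RamProg.run, digraphInput]
    · intro i hi
      simp [RamProg.run, digraphInput] at hi
    · intro a ha i
      have h0 : a ≠ 0 := by omega
      have h1 : a ≠ 1 := by omega
      simp [RamProg.run, digraphInput, h0, h1]
    · simp [RamProg.run, digraphInput]
  · rw [hx, hy, hz]
    simp only [RamProg.maxCost, RamExpr.cost, RamProg.loadVertex]
    -- A directed co-graph has a vertex, so `n ≥ 1` absorbs the final test of every loop and the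
    -- cost of the straight-line code.
    have e₁ : (2 * n + 1) * (x + 6) ≤ 3 * (x + 6) * (n + l.length) := by
      calc (2 * n + 1) * (x + 6) ≤ (3 * (n + l.length)) * (x + 6) :=
            Nat.mul_le_mul_right _ (by omega)
        _ = _ := by ring
    have e₂ : (l.length + 1) * (y + 4) ≤ (y + 4) * (n + l.length) := by
      rw [mul_comm]
      exact Nat.mul_le_mul_left _ (by omega)
    have e₃ : (2 * n + 1) * (z + 4) ≤ 3 * (z + 4) * (n + l.length) := by
      calc (2 * n + 1) * (z + 4) ≤ (3 * (n + l.length)) * (z + 4) :=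
            Nat.mul_le_mul_right _ (by omega)
        _ = _ := by ring
    have e₄ : 100 ≤ 100 * (n + l.length) := by omega
    rw [add_mul, add_mul, add_mul]
    ring_nf at e₁ e₂ e₃ e₄ ⊢
    omega

end Digraph
theorem mainTheorem9 :
    -- a Hamiltonian path exists iff `p(G, V(G)) = 1`
    (∀ (V : Type*) [Finite V] (G : Digraph V),
      HasHamiltonianPath G ↔ pathCoverNumber G Set.univ = 1) ∧
    -- linear time for a directed co-graph given by its vertices and arcs
    (∃ (P : RamProg) (c : ℕ), ∀ (n : ℕ) (G : Digraph (Fin n)) (l : List (Fin n × Fin n)),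
      IsDirectedCograph G → ListsArcs G l →
        SolvesHamiltonianPathWithin P (digraphInput n l) G (c * (n + l.length))) ∧
    -- linear time in the size of a directed co-expression, when that is given instead
    (∃ (P : RamProg) (c : ℕ), ∀ (n : ℕ) (G : Digraph (Fin n)) (e : CoExpr (Fin n)),
      e.Represents G →
        SolvesHamiltonianPathWithin P (wordInput e.code) G (c * e.size)) := by
  exact ⟨fun V _ G => hasHamiltonianPath_iff_pathCoverNumber_eq_one G, exists_prog_digraph,
    exists_prog_coExpr⟩
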